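/- Let $k$ be a commutative ring, let $H$ be a commutative Hopf algebra over $k$ with antipode $S$ (so $S^2=\mathrm{id}$), and write $\otimes=\otimes_k$. Let $C$ be a Galois co-object for $H$, that is, a right $H$-module coalgebra such that the adjoint functors $-\otimes_H k$ (from $(H,C)$-Hopf modules to $k$-modules) and $-\otimes C$ are inverse equivalences. Regard $C$ as an $H$-bimodule with equal left and right actions, and let $\widehat C$ be the $k$-module $C$ with the (left and right) $H$-action $h\rightharpoonup c=c\,S^{-1}(h)$. The map $\delta\colon C\otimes H\to C\otimes C$, $c\otimes h\mapsto c_{(1)}\otimes c_{(2)}h$, is bijective, and $C$ is an $H$-$H$ bimodule herd with pen $\widehat C$, evaluations $$\mathrm{ev}=(\varepsilon_C\otimes H)\circ\delta^{-1}\colon\widehat C\otimes C\to H,\qquad \widehat{\mathrm{ev}}=S\circ\mathrm{ev}\colon C\otimes\widehat C\to H,$$ and shepherd $\Delta_C^2=(C\otimes\Delta_C)\circ\Delta_C\colon C\to C\otimes\widehat C\otimes C$. Let $E\subseteq\widehat C\otimes C$ be the equaliser of $(\mathrm{ev}\otimes\widehat C\otimes C)\circ(\widehat C\otimes\Delta_C^2)$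 and $1_H\otimes\widehat C\otimes C$, and let $F\subseteq C\otimes\widehat C$ be the equaliser of $(C\otimes\widehat C\otimes\widehat{\mathrm{ev}})\circ(\Delta_C^2\otimes\widehat C)$ and $C\otimes\widehat C\otimes 1_H$. Then: 1. $E$ has a unique $k$-coalgebra structure whose coproduct is the restriction of $\widehat C\otimes\Delta_C^2$ and whose counit is the restriction of $\mathrm{ev}$, and with it $E\cong C$ as coalgebras. 2. $F$ has a unique $k$-coalgebra structure whose coproduct is the restriction of $\Delta_C^2\otimes\widehat C$ and whose counit is the restriction of $\widehat{\mathrm{ev}}$, and with it $F\cong C$ as coalgebras. 3. Suppose that $C$ is flat over $k$. Then the herd $C$ is tame: $\mathrm{ev}$ and $\widehat{\mathrm{ev}}$ are surjective and $C$ is faithfully flat over $k$. Let $\overline C=(E\otimes\widehat C)\cap(\widehat C\otimes F)\subseteq\widehat C\otimes C\otimes\widehat C$. Then $C$ is an $F$-$E$ bicomodule coherd with companion $\overline C$, with all coactions induced by $\Delta_C^2$, with $\mathrm{cov}\colon E\to\overline C\otimes C$ and $\overline{\mathrm{cov}}\colon F\to C\otimes\overline C$ induced by $\widehat C\otimes\Delta_C^2$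 and $\Delta_C^2\otimes\widehat C$, and with structure map $$\chi\colon C\otimes\overline C\otimes C\to C,\qquad x\otimes(y\otimes x'\otimes y')\otimes x''\mapsto\widehat{\mathrm{ev}}(x\otimes y)\,x'\,\mathrm{ev}(y'\otimes x'').$$ The (a priori non-unital) rings reconstructed from this coherd, namely $$A'=\mathrm{coeq}\bigl((\overline C\otimes\chi)\circ(\mathrm{cov}\otimes\overline C\otimes C),\ \varepsilon_E\otimes\overline C\otimes C\colon E\otimes\overline C\otimes C\to\overline C\otimes C\bigr),$$ with product induced by $\overline C\otimes\chi$, and $$B'=\mathrm{coeq}\bigl((\chi\otimes\overline C)\circ(C\otimes\overline C\otimes\overline{\mathrm{cov}}),\ C\otimes\overline C\otimes\varepsilon_F\colon C\otimes\overline C\otimes F\to C\otimes\overline C\bigr),$$ with product induced by $\chi\otimes\overline C$, are both isomorphic to $H$, by $k$-linear ring isomorphisms. -/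

import Mathlib

open scoped TensorProduct
open Coalgebra HopfAlgebra MulOpposite

universe u

set_option linter.unusedSectionVars false

noncomputable section

/-! ### Actions as linear maps -/

namespace BimoduleHerd

section Actions

variable (k : Type u) [CommRing k]

/-- The left action `B ⊗ T → T`, `b ⊗ x ↦ b x`. -/
def actL (B T : Type u) [Ring B] [Algebra k B] [AddCommGroup T] [Module k T] [Module B T]
    [IsScalarTower k B T] : B ⊗[k] T →ₗ[k] T :=
  TensorProduct.lift (Algebra.lsmul k k T : B →ₐ[k] Module.End k T).toLinearMap

/-- The right action `T ⊗ A → T`, `x ⊗ a ↦ x a`. -/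
def actR (A T : Type u) [Ring A] [Algebra k A] [AddCommGroup T] [Module k T] [Module Aᵐᵒᵖ T]
    [IsScalarTower k Aᵐᵒᵖ T] : T ⊗[k] A →ₗ[k] T :=
  TensorProduct.lift (((Algebra.lsmul k k T : Aᵐᵒᵖ →ₐ[k] Module.End k T).toLinearMap ∘ₗ
    (opLinearEquiv k : A ≃ₗ[k] Aᵐᵒᵖ).toLinearMap).flip)

@[simp] theorem actL_tmul {B T : Type u} [Ring B] [Algebra k B] [AddCommGroup T] [Module k T]
    [Module B T] [IsScalarTower k B T] (b : B) (x : T) : actL k B T (b ⊗ₜ x) = b • x := rfl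

@[simp] theorem actR_tmul {A T : Type u} [Ring A] [Algebra k A] [AddCommGroup T] [Module k T]
    [Module Aᵐᵒᵖ T] [IsScalarTower k Aᵐᵒᵖ T] (x : T) (a : A) :
    actR k A T (x ⊗ₜ a) = op a • x := rfl

end Actions

/-! ### Bimodule herds over `k`-algebras -/

section Herd

variable (k A B T That : Type u) [CommRing k] [Ring A] [Algebra k A] [Ring B] [Algebra k B]
  [AddCommGroup T] [Module k T] [Module B T] [Module Aᵐᵒᵖ T] [SMulCommClass B Aᵐᵒᵖ T]
  [IsScalarTower k B T] [IsScalarTower k Aᵐᵒᵖ T]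
  [AddCommGroup That] [Module k That] [Module A That] [Module Bᵐᵒᵖ That]
  [SMulCommClass A Bᵐᵒᵖ That] [IsScalarTower k A That] [IsScalarTower k Bᵐᵒᵖ That]

/-- The `A`-`B` bimodule `That` as a formal dual of the `B`-`A` bimodule `T`, where `A` and `B`
are `k`-algebras (the base ring of both `A` and `B` is `k`). -/
structure FormalDual where
  /-- the evaluation `That ⊗ T → A`, a map of `A`-bimodules -/
  ev : That ⊗[k] T →ₗ[k] A
  /-- the evaluation `T ⊗ That → B`, a map of `B`-bimodules -/
  evHat : T ⊗[k] That →ₗ[k] B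
  ev_left : ∀ (a : A) (y : That) (x : T), ev ((a • y) ⊗ₜ x) = a * ev (y ⊗ₜ x)
  ev_right : ∀ (a : A) (y : That) (x : T), ev (y ⊗ₜ (op a • x)) = ev (y ⊗ₜ x) * a
  evHat_left : ∀ (b : B) (x : T) (y : That), evHat ((b • x) ⊗ₜ y) = b * evHat (x ⊗ₜ y)
  evHat_right : ∀ (b : B) (x : T) (y : That), evHat (x ⊗ₜ (op b • y)) = evHat (x ⊗ₜ y) * b
  evHat_smul : ∀ (x : T) (y : That) (x' : T),
    evHat (x ⊗ₜ y) • x' = op (ev (y ⊗ₜ x')) • x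
  smul_evHat : ∀ (y : That) (x : T) (y' : That),
    op (evHat (x ⊗ₜ y')) • y = ev (y ⊗ₜ x) • y'

/-- A `B`-`A` herd structure on `T`, with pen `That` and shepherd `γ : T → T ⊗ That ⊗ T`. -/
structure Herd extends FormalDual k A B T That where
  γ : T →ₗ[k] T ⊗[k] (That ⊗[k] T)
  evHat_γ : ∀ x : T,
    evHat.rTensor T ((TensorProduct.assoc k T That T).symm (γ x)) = (1 : B) ⊗ₜ[k] x
  ev_γ : ∀ x : T, ev.lTensor T (γ x) = x ⊗ₜ[k] (1 : A)
  coassoc_γ : ∀ x : T,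
    (TensorProduct.assoc k That T (That ⊗[k] T)).toLinearMap.lTensor T
      (TensorProduct.assoc k T (That ⊗[k] T) (That ⊗[k] T) (γ.rTensor (That ⊗[k] T) (γ x))) =
    (γ.lTensor That).lTensor T (γ x)

end Herd

namespace Herd

variable {k A B T That : Type u} [CommRing k] [Ring A] [Algebra k A] [Ring B] [Algebra k B]
  [AddCommGroup T] [Module k T] [Module B T] [Module Aᵐᵒᵖ T] [SMulCommClass B Aᵐᵒᵖ T]
  [IsScalarTower k B T] [IsScalarTower k Aᵐᵒᵖ T]
  [AddCommGroup That] [Module k That] [Module A That] [Module Bᵐᵒᵖ That]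
  [SMulCommClass A Bᵐᵒᵖ That] [IsScalarTower k A That] [IsScalarTower k Bᵐᵒᵖ That]
  (G : Herd k A B T That)

/-- A herd is tame if both evaluations are surjective and `T` is faithfully flat over `k`. -/
structure IsTame : Prop where
  ev_surjective : Function.Surjective G.ev
  evHat_surjective : Function.Surjective G.evHat
  faithfullyFlat : Module.FaithfullyFlat k T

/-- `That ⊗ γ`, with values in `(That ⊗ T) ⊗ (That ⊗ T)`. -/
def hatγ : That ⊗[k] T →ₗ[k] (That ⊗[k] T) ⊗[k] (That ⊗[k] T) :=
  (TensorProduct.assoc k That T (That ⊗[k] T)).symm.toLinearMap ∘ₗ G.γ.lTensor That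

/-- `γ ⊗ That`, with values in the right nested tensor product `T ⊗ That ⊗ T ⊗ That`. -/
def γhatNested : T ⊗[k] That →ₗ[k] T ⊗[k] (That ⊗[k] (T ⊗[k] That)) :=
  (TensorProduct.assoc k That T That).toLinearMap.lTensor T ∘ₗ
    (TensorProduct.assoc k T (That ⊗[k] T) That).toLinearMap ∘ₗ G.γ.rTensor That

/-- `γ ⊗ That`, with values in `(T ⊗ That) ⊗ (T ⊗ That)`. -/
def γhat : T ⊗[k] That →ₗ[k] (T ⊗[k] That) ⊗[k] (T ⊗[k] That) :=
  (TensorProduct.assoc k T That (T ⊗[k] That)).symm.toLinearMap ∘ₗ G.γhatNested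

/-- The equaliser of `(ev ⊗ That ⊗ T) ∘ (That ⊗ γ)` and `1 ⊗ That ⊗ T`. -/
def E : Submodule k (That ⊗[k] T) :=
  LinearMap.eqLocus (G.ev.rTensor (That ⊗[k] T) ∘ₗ G.hatγ)
    (TensorProduct.mk k A (That ⊗[k] T) 1)

/-- The equaliser of `(T ⊗ That ⊗ evHat) ∘ (γ ⊗ That)` and `T ⊗ That ⊗ 1`. -/
def F : Submodule k (T ⊗[k] That) :=
  LinearMap.eqLocus (G.evHat.lTensor (T ⊗[k] That) ∘ₗ G.γhat)
    ((TensorProduct.mk k (T ⊗[k] That) B).flip 1)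

/-- The given coalgebra structure on `E` is the one attached to the herd: its coproduct is the
restriction of `That ⊗ γ`, and its counit is the restriction of `ev`. -/
structure IsCoalgebraE (cE : Coalgebra k G.E) : Prop where
  comul_eq : ∀ e : G.E, TensorProduct.map G.E.subtype G.E.subtype (comul (R := k) e) = G.hatγ e
  counit_eq : ∀ e : G.E, algebraMap k A (counit (R := k) e) = G.ev e

/-- The given coalgebra structure on `F` is the one attached to the herd: its coproduct is the
restriction of `γ ⊗ That`, and its counit is the restriction of `evHat`. -/
structure IsCoalgebraF (cF : Coalgebra k G.F) : Prop where
  comul_eq : ∀ f : G.F, TensorProduct.map G.F.subtype G.F.subtype (comul (R := k) f) = G.γhat f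
  counit_eq : ∀ f : G.F, algebraMap k B (counit (R := k) f) = G.evHat f

end Herd

/-! ### Bicomodule coherds over `k`-coalgebras -/

section Comodule

variable {k D X C : Type u} [CommRing k] [AddCommGroup D] [Module k D] [Coalgebra k D]
  [AddCommGroup C] [Module k C] [Coalgebra k C] [AddCommGroup X] [Module k X]

/-- `ρ` is a right `C`-coaction on `X`. -/
structure IsRightCoaction (ρ : X →ₗ[k] X ⊗[k] C) : Prop where
  coassoc : (TensorProduct.assoc k X C C).toLinearMap ∘ₗ ρ.rTensor C ∘ₗ ρ =
    (comul : C →ₗ[k] C ⊗[k] C).lTensor X ∘ₗ ρ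
  counit : (counit : C →ₗ[k] k).lTensor X ∘ₗ ρ = (TensorProduct.mk k X k).flip 1

/-- `ρ` is a left `D`-coaction on `X`. -/
structure IsLeftCoaction (ρ : X →ₗ[k] D ⊗[k] X) : Prop where
  coassoc : (TensorProduct.assoc k D D X).toLinearMap ∘ₗ
    (comul : D →ₗ[k] D ⊗[k] D).rTensor X ∘ₗ ρ = ρ.lTensor D ∘ₗ ρ
  counit : (counit : D →ₗ[k] k).rTensor X ∘ₗ ρ = TensorProduct.mk k k X 1

/-- `ρl` and `ρr` make `X` a `D`-`C` bicomodule. -/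
structure IsBicomodule (ρl : X →ₗ[k] D ⊗[k] X) (ρr : X →ₗ[k] X ⊗[k] C) : Prop where
  left : IsLeftCoaction ρl
  right : IsRightCoaction ρr
  comm : (TensorProduct.assoc k D X C).toLinearMap ∘ₗ ρl.rTensor C ∘ₗ ρr = ρr.lTensor D ∘ₗ ρl

end Comodule

/-- A bicomodule coherd: a `D`-`C` bicomodule `X` with a companion `Xbar` (a `C`-`D` bicomodule)
and a structure map `χ`, where `C` and `D` are `k`-coalgebras. -/
structure Coherd (k C D X Xbar : Type u) [CommRing k] [AddCommGroup C] [Module k C]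
    [Coalgebra k C] [AddCommGroup D] [Module k D] [Coalgebra k D] [AddCommGroup X] [Module k X]
    [AddCommGroup Xbar] [Module k Xbar] where
  ρDX : X →ₗ[k] D ⊗[k] X
  ρXC : X →ₗ[k] X ⊗[k] C
  ρCXbar : Xbar →ₗ[k] C ⊗[k] Xbar
  ρXbarD : Xbar →ₗ[k] Xbar ⊗[k] D
  cov : C →ₗ[k] Xbar ⊗[k] X
  covBar : D →ₗ[k] X ⊗[k] Xbar
  χ : X ⊗[k] (Xbar ⊗[k] X) →ₗ[k] X
  bicomodule_X : IsBicomodule ρDX ρXC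
  bicomodule_Xbar : IsBicomodule ρCXbar ρXbarD
  -- `cov` is a map of `C`-bicomodules
  cov_left : (TensorProduct.assoc k C Xbar X).toLinearMap ∘ₗ ρCXbar.rTensor X ∘ₗ cov =
    cov.lTensor C ∘ₗ comul
  cov_right : ρXC.lTensor Xbar ∘ₗ cov =
    (TensorProduct.assoc k Xbar X C).toLinearMap ∘ₗ cov.rTensor C ∘ₗ comul
  -- `covBar` is a map of `D`-bicomodules
  covBar_left : (TensorProduct.assoc k D X Xbar).toLinearMap ∘ₗ ρDX.rTensor Xbar ∘ₗ covBar =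
    covBar.lTensor D ∘ₗ comul
  covBar_right : ρXbarD.lTensor X ∘ₗ covBar =
    (TensorProduct.assoc k X Xbar D).toLinearMap ∘ₗ covBar.rTensor D ∘ₗ comul
  -- compatibility of the companion maps with the coactions
  companion_X : cov.lTensor X ∘ₗ ρXC =
    (TensorProduct.assoc k X Xbar X).toLinearMap ∘ₗ covBar.rTensor X ∘ₗ ρDX
  companion_Xbar : (TensorProduct.assoc k Xbar X Xbar).toLinearMap ∘ₗ cov.rTensor Xbar ∘ₗ ρCXbar =
    covBar.lTensor Xbar ∘ₗ ρXbarD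
  -- counitality and associativity of `χ`
  χ_cov : χ ∘ₗ cov.lTensor X =
    (TensorProduct.rid k X).toLinearMap ∘ₗ (counit : C →ₗ[k] k).lTensor X
  χ_covBar : χ ∘ₗ (TensorProduct.assoc k X Xbar X).toLinearMap ∘ₗ covBar.rTensor X =
    (TensorProduct.lid k X).toLinearMap ∘ₗ (counit : D →ₗ[k] k).rTensor X
  χ_assoc : ∀ (x : X) (y : Xbar) (x' : X) (y' : Xbar) (x'' : X),
    χ (χ (x ⊗ₜ (y ⊗ₜ x')) ⊗ₜ (y' ⊗ₜ x'')) = χ (x ⊗ₜ (y ⊗ₜ χ (x' ⊗ₜ (y' ⊗ₜ x''))))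

/-- The non-unital ring structure on the quotient of `M` by an ideal `I`, for an associative
product on the module `M`. -/
@[reducible] def quotRing {k M : Type u} [CommRing k] [AddCommGroup M] [Module k M]
    (μ : M →ₗ[k] M →ₗ[k] M) (hμ : ∀ x y z, μ (μ x y) z = μ x (μ y z)) (I : Submodule k M)
    (hl : ∀ x, ∀ y ∈ I, μ x y ∈ I) (hr : ∀ x ∈ I, ∀ y, μ x y ∈ I) : NonUnitalRing (M ⧸ I) :=
  let m : M ⧸ I →ₗ[k] M ⧸ I →ₗ[k] M ⧸ I :=
    I.liftQ (LinearMap.mk₂ k (fun x (y : M ⧸ I) => I.mapQ I (μ x) (fun y hy => hl x y hy) y)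
      (fun x x' y => by
        obtain ⟨y, rfl⟩ := I.mkQ_surjective y; simp)
      (fun c x y => by
        obtain ⟨y, rfl⟩ := I.mkQ_surjective y; simp)
      (fun x y y' => by simp) (fun c x y => by simp))
      (fun x hx => by
        rw [LinearMap.mem_ker]
        ext y
        simpa using hr x hx y)
  { (inferInstance : AddCommGroup (M ⧸ I)) with
    mul := fun a b => m a b
    left_distrib := fun a b c => map_add (m a) b c
    right_distrib := fun a b c => by
      change m (a + b) c = m a c + m b c
      simp
    zero_mul := fun a => by change m 0 a = 0; simp
    mul_zero := fun a => map_zero (m a)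
    mul_assoc := fun a b c => by
      change m (m a b) c = m a (m b c)
      obtain ⟨a, rfl⟩ := I.mkQ_surjective a
      obtain ⟨b, rfl⟩ := I.mkQ_surjective b
      obtain ⟨c, rfl⟩ := I.mkQ_surjective c
      simp [m, hμ] }

namespace Coherd

variable {k C D X Xbar : Type u} [CommRing k] [AddCommGroup C] [Module k C]
    [Coalgebra k C] [AddCommGroup D] [Module k D] [Coalgebra k D] [AddCommGroup X] [Module k X]
    [AddCommGroup Xbar] [Module k Xbar] (K : Coherd k C D X Xbar)

/-- The product `Xbar ⊗ χ` of `Xbar ⊗ X`. -/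
def mulA : Xbar ⊗[k] X →ₗ[k] Xbar ⊗[k] X →ₗ[k] Xbar ⊗[k] X :=
  TensorProduct.curry (K.χ.lTensor Xbar ∘ₗ (TensorProduct.assoc k Xbar X (Xbar ⊗[k] X)).toLinearMap)

/-- The product `χ ⊗ Xbar` of `X ⊗ Xbar`. -/
def mulB : X ⊗[k] Xbar →ₗ[k] X ⊗[k] Xbar →ₗ[k] X ⊗[k] Xbar :=
  TensorProduct.curry (K.χ.rTensor Xbar ∘ₗ
    (TensorProduct.assoc k X (Xbar ⊗[k] X) Xbar).symm.toLinearMap ∘ₗ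
    (TensorProduct.assoc k Xbar X Xbar).symm.toLinearMap.lTensor X ∘ₗ
    (TensorProduct.assoc k X Xbar (X ⊗[k] Xbar)).toLinearMap)

/-- The difference `C ⊗ Xbar ⊗ X → Xbar ⊗ X` of the two maps whose coequaliser is `A'`. -/
def ωA : C ⊗[k] (Xbar ⊗[k] X) →ₗ[k] Xbar ⊗[k] X :=
  TensorProduct.lift (K.mulA ∘ₗ K.cov) -
    (TensorProduct.lid k (Xbar ⊗[k] X)).toLinearMap ∘ₗ
      (counit : C →ₗ[k] k).rTensor (Xbar ⊗[k] X)

/-- The difference `X ⊗ Xbar ⊗ D → X ⊗ Xbar` of the two maps whose coequaliser is `B'`. -/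
def ωB : (X ⊗[k] Xbar) ⊗[k] D →ₗ[k] X ⊗[k] Xbar :=
  TensorProduct.lift ((K.mulB.flip ∘ₗ K.covBar).flip) -
    (TensorProduct.rid k (X ⊗[k] Xbar)).toLinearMap ∘ₗ
      (counit : D →ₗ[k] k).lTensor (X ⊗[k] Xbar)

/-- The ring `A'` attached to a coherd, as a `k`-module: the coequaliser of
`(Xbar ⊗ χ) ∘ (cov ⊗ Xbar ⊗ X)` and `ε_C ⊗ Xbar ⊗ X`. -/
def ringA : Type u := (Xbar ⊗[k] X) ⧸ LinearMap.range K.ωA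

/-- The ring `B'` attached to a coherd, as a `k`-module: the coequaliser of
`(χ ⊗ Xbar) ∘ (X ⊗ Xbar ⊗ covBar)` and `X ⊗ Xbar ⊗ ε_D`. -/
def ringB : Type u := (X ⊗[k] Xbar) ⧸ LinearMap.range K.ωB

theorem mulA_tmul (y : Xbar) (x : X) (u : Xbar ⊗[k] X) :
    K.mulA (y ⊗ₜ x) u = y ⊗ₜ K.χ (x ⊗ₜ u) := by
  simp [mulA]

theorem mulB_tmul (x : X) (y : Xbar) (x' : X) (y' : Xbar) :
    K.mulB (x ⊗ₜ y) (x' ⊗ₜ y') = K.χ (x ⊗ₜ (y ⊗ₜ x')) ⊗ₜ y' := by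
  simp [mulB]

theorem mulB_tmul_right (u : X ⊗[k] Xbar) (x' : X) (y' : Xbar) :
    K.mulB u (x' ⊗ₜ y') = K.χ (TensorProduct.assoc k X Xbar X (u ⊗ₜ x')) ⊗ₜ y' := by
  induction u with
  | zero => simp
  | add u v hu hv => simp [hu, hv, TensorProduct.add_tmul]
  | tmul x y => simp [mulB_tmul]

theorem mulA_assoc (u v w : Xbar ⊗[k] X) : K.mulA (K.mulA u v) w = K.mulA u (K.mulA v w) := by
  induction u with
  | zero => simp
  | add u v hu hv => simp [hu, hv]
  | tmul y x =>
    induction v with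
    | zero => simp
    | add u v hu hv => simp [hu, hv]
    | tmul y' x' =>
      induction w with
      | zero => simp
      | add u v hu hv => simp [hu, hv]
      | tmul y'' x'' => simp [mulA_tmul, χ_assoc]

theorem mulB_assoc (u v w : X ⊗[k] Xbar) : K.mulB (K.mulB u v) w = K.mulB u (K.mulB v w) := by
  induction u with
  | zero => simp
  | add u v hu hv => simp [hu, hv]
  | tmul y x =>
    induction v with
    | zero => simp
    | add u v hu hv => simp [hu, hv]
    | tmul y' x' =>
      induction w with
      | zero => simp
      | add u v hu hv => simp [hu, hv]
      | tmul y'' x'' => simp [mulB_tmul, χ_assoc]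

theorem mulA_cov (u : Xbar ⊗[k] X) (c : C) :
    K.mulA u (K.cov c) = counit (R := k) c • u := by
  induction u with
  | zero => simp
  | add u v hu hv => simp [hu, hv]
  | tmul y x =>
    have := LinearMap.congr_fun K.χ_cov (x ⊗ₜ c)
    simp only [LinearMap.comp_apply, LinearMap.lTensor_tmul, LinearEquiv.coe_coe,
      TensorProduct.rid_tmul] at this
    simp [mulA_tmul, this]

theorem mulB_covBar (u : X ⊗[k] Xbar) (d : D) :
    K.mulB (K.covBar d) u = counit (R := k) d • u := by
  induction u with
  | zero => simp
  | add u v hu hv => simp [hu, hv]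
  | tmul x y =>
    have := LinearMap.congr_fun K.χ_covBar (d ⊗ₜ x)
    simp only [LinearMap.comp_apply, LinearMap.rTensor_tmul, LinearEquiv.coe_coe,
      TensorProduct.lid_tmul] at this
    simp [mulB_tmul_right, this, TensorProduct.smul_tmul']

theorem ωA_tmul (c : C) (u : Xbar ⊗[k] X) :
    K.ωA (c ⊗ₜ u) = K.mulA (K.cov c) u - counit (R := k) c • u := by
  simp [ωA]

theorem ωB_tmul (u : X ⊗[k] Xbar) (d : D) :
    K.ωB (u ⊗ₜ d) = K.mulB u (K.covBar d) - counit (R := k) d • u := by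
  simp [ωB]

/-- The product of `A'` is induced by the product `Xbar ⊗ χ`. -/
instance : NonUnitalRing K.ringA :=
  quotRing K.mulA K.mulA_assoc (LinearMap.range K.ωA)
    (by
      rintro u _ ⟨t, rfl⟩
      have : K.mulA u (K.ωA t) = 0 := by
        induction t with
        | zero => simp
        | add u v hu hv => simp [hu, hv]
        | tmul c v => simp [ωA_tmul, ← mulA_assoc, mulA_cov]
      rw [this]
      exact zero_mem _)
    (by
      rintro _ ⟨t, rfl⟩ v
      induction t with
      | zero => simp
      | add u v hu hv => simpa using add_mem hu hv
      | tmul c u => exact ⟨c ⊗ₜ K.mulA u v, by simp [ωA_tmul, mulA_assoc]⟩)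

/-- The product of `B'` is induced by the product `χ ⊗ Xbar`. -/
instance : NonUnitalRing K.ringB :=
  quotRing K.mulB K.mulB_assoc (LinearMap.range K.ωB)
    (by
      rintro u _ ⟨t, rfl⟩
      induction t with
      | zero => simp
      | add u v hu hv => simpa using add_mem hu hv
      | tmul v d => exact ⟨K.mulB u v ⊗ₜ d, by simp [ωB_tmul, mulB_assoc]⟩)
    (by
      rintro _ ⟨t, rfl⟩ v
      have : K.mulB (K.ωB t) v = 0 := by
        induction t with
        | zero => simp
        | add u v hu hv => simp [hu, hv]
        | tmul v d => simp [ωB_tmul, mulB_assoc, mulB_covBar]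
      rw [this]
      exact zero_mem _)

instance : Module k K.ringA :=
  inferInstanceAs (Module k ((Xbar ⊗[k] X) ⧸ LinearMap.range K.ωA))

instance : Module k K.ringB :=
  inferInstanceAs (Module k ((X ⊗[k] Xbar) ⧸ LinearMap.range K.ωB))

end Coherd

/-! ### The coherd associated to a herd -/

namespace Herd

variable {k A B T That : Type u} [CommRing k] [Ring A] [Algebra k A] [Ring B] [Algebra k B]
  [AddCommGroup T] [Module k T] [Module B T] [Module Aᵐᵒᵖ T] [SMulCommClass B Aᵐᵒᵖ T]
  [IsScalarTower k B T] [IsScalarTower k Aᵐᵒᵖ T]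
  [AddCommGroup That] [Module k That] [Module A That] [Module Bᵐᵒᵖ That]
  [SMulCommClass A Bᵐᵒᵖ That] [IsScalarTower k A That] [IsScalarTower k Bᵐᵒᵖ That]
  (G : Herd k A B T That)

/-- The intersection `(E ⊗ That) ∩ (That ⊗ F)` in `That ⊗ T ⊗ That`. -/
def bar : Submodule k (That ⊗[k] (T ⊗[k] That)) :=
  LinearMap.range ((TensorProduct.assoc k That T That).toLinearMap ∘ₗ
    G.E.subtype.rTensor That) ⊓
  LinearMap.range (G.F.subtype.lTensor That)

/-- `That ⊗ γ ⊗ That`, with values in the right nested tensor product. -/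
def hatγhat : That ⊗[k] (T ⊗[k] That) →ₗ[k]
    That ⊗[k] (T ⊗[k] (That ⊗[k] (T ⊗[k] That))) :=
  G.γhatNested.lTensor That

/-- The map `T ⊗ (That ⊗ T ⊗ That) ⊗ T → T`,
`x ⊗ (y ⊗ x' ⊗ y') ⊗ x'' ↦ evHat (x ⊗ y) x' ev (y' ⊗ x'')`. -/
def χFull : T ⊗[k] ((That ⊗[k] (T ⊗[k] That)) ⊗[k] T) →ₗ[k] T :=
  actL k B T ∘ₗ
  TensorProduct.map G.evHat
    (actR k A T ∘ₗ G.ev.lTensor T ∘ₗ (TensorProduct.assoc k T That T).toLinearMap) ∘ₗ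
  (TensorProduct.assoc k T That ((T ⊗[k] That) ⊗[k] T)).symm.toLinearMap ∘ₗ
  (TensorProduct.assoc k That (T ⊗[k] That) T).toLinearMap.lTensor T

theorem χFull_tmul (x : T) (y : That) (x' : T) (y' : That) (x'' : T) :
    G.χFull (x ⊗ₜ ((y ⊗ₜ (x' ⊗ₜ y')) ⊗ₜ x'')) =
      G.evHat (x ⊗ₜ y) • op (G.ev (y' ⊗ₜ x'')) • x' := by
  simp [χFull]

/-- The `F`-`E` coherd `T` associated to the herd `T`, with companion `G.bar`; `E` and `F` carry
the coalgebra structures attached to the herd. All structure maps of the coherd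
are the restrictions of the canonical maps prescribed by the herd. -/
structure AssociatedCoherd where
  [coalgebraE : Coalgebra k G.E]
  [coalgebraF : Coalgebra k G.F]
  isCoalgebraE : G.IsCoalgebraE coalgebraE
  isCoalgebraF : G.IsCoalgebraF coalgebraF
  coherd : Coherd k G.E G.F T G.bar
  -- both coactions on `T` are `γ`
  ρXC_eq : ∀ x : T, G.E.subtype.lTensor T (coherd.ρXC x) = G.γ x
  ρDX_eq : ∀ x : T,
    TensorProduct.assoc k T That T (G.F.subtype.rTensor T (coherd.ρDX x)) = G.γ x
  -- both coactions on `G.bar` are `That ⊗ γ ⊗ That`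
  ρCXbar_eq : ∀ y : G.bar,
    TensorProduct.assoc k That T (That ⊗[k] (T ⊗[k] That))
      (TensorProduct.map G.E.subtype G.bar.subtype (coherd.ρCXbar y)) = G.hatγhat y
  ρXbarD_eq : ∀ y : G.bar,
    (TensorProduct.assoc k T That (T ⊗[k] That)).toLinearMap.lTensor That
      (TensorProduct.assoc k That (T ⊗[k] That) (T ⊗[k] That)
        (TensorProduct.map G.bar.subtype G.F.subtype (coherd.ρXbarD y))) = G.hatγhat y
  -- `cov` is `That ⊗ γ`, and `covBar` is `γ ⊗ That`
  cov_eq : ∀ e : G.E,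
    (TensorProduct.assoc k T That T).toLinearMap.lTensor That
      (TensorProduct.assoc k That (T ⊗[k] That) T
        (G.bar.subtype.rTensor T (coherd.cov e))) = G.γ.lTensor That e
  covBar_eq : ∀ f : G.F, G.bar.subtype.lTensor T (coherd.covBar f) = G.γhatNested f
  -- `χ` is `x ⊗ (y ⊗ x' ⊗ y') ⊗ x'' ↦ evHat (x ⊗ y) x' ev (y' ⊗ x'')`
  χ_eq : coherd.χ = G.χFull ∘ₗ (G.bar.subtype.rTensor T).lTensor T

namespace AssociatedCoherd

variable {G} (K : G.AssociatedCoherd)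

/-- The ring `A'` of the coherd associated to the herd. -/
def ringA : Type u :=
  letI := K.coalgebraE
  letI := K.coalgebraF
  K.coherd.ringA

/-- The ring `B'` of the coherd associated to the herd. -/
def ringB : Type u :=
  letI := K.coalgebraE
  letI := K.coalgebraF
  K.coherd.ringB

instance : NonUnitalRing K.ringA :=
  letI := K.coalgebraE
  letI := K.coalgebraF
  inferInstanceAs (NonUnitalRing K.coherd.ringA)

instance : NonUnitalRing K.ringB :=
  letI := K.coalgebraE
  letI := K.coalgebraF
  inferInstanceAs (NonUnitalRing K.coherd.ringB)

instance : Module k K.ringA :=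
  letI := K.coalgebraE
  letI := K.coalgebraF
  inferInstanceAs (Module k K.coherd.ringA)

instance : Module k K.ringB :=
  letI := K.coalgebraE
  letI := K.coalgebraF
  inferInstanceAs (Module k K.coherd.ringB)

end AssociatedCoherd

end Herd
end BimoduleHerd

/-! ### Galois co-objects of a commutative Hopf algebra -/

namespace GaloisCoobject

open BimoduleHerd

section HopfModules

/-- The diagonal action of `H ⊗ H` on `M ⊗ N`. -/
def diagAct (k H M N : Type u) [CommRing k] [CommRing H] [Algebra k H]
    [AddCommGroup M] [Module k M] [Module H M] [IsScalarTower k H M]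
    [AddCommGroup N] [Module k N] [Module H N] [IsScalarTower k H N] :
    H ⊗[k] H →ₗ[k] M ⊗[k] N →ₗ[k] M ⊗[k] N :=
  TensorProduct.map₂ (Algebra.lsmul k k M : H →ₐ[k] Module.End k M).toLinearMap
    (Algebra.lsmul k k N : H →ₐ[k] Module.End k N).toLinearMap

@[simp] theorem diagAct_tmul (k : Type u) {H M N : Type u} [CommRing k] [CommRing H] [Algebra k H]
    [AddCommGroup M] [Module k M] [Module H M] [IsScalarTower k H M]
    [AddCommGroup N] [Module k N] [Module H N] [IsScalarTower k H N] (g h : H) (m : M) (n : N) :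
    diagAct k H M N (g ⊗ₜ h) (m ⊗ₜ n) = (g • m) ⊗ₜ (h • n) := rfl

variable (k H C : Type u) [CommRing k] [CommRing H] [HopfAlgebra k H]
  [AddCommGroup C] [Module k C] [Coalgebra k C] [Module H C] [IsScalarTower k H C]

/-- `C` is an `H`-module coalgebra. As `H` is commutative, right `H`-modules are written as
left modules. -/
class IsModuleCoalgebra : Prop where
  comul_smul : ∀ (h : H) (c : C),
    comul (R := k) (h • c) = diagAct k H C C (comul (R := k) h) (comul (R := k) c)
  counit_smul : ∀ (h : H) (c : C),
    counit (R := k) (h • c) = counit (R := k) h * counit (R := k) c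

variable {k H C} in
/-- The `H`-module `M` with the right `C`-coaction `ρ` is an `(H, C)`-Hopf module. -/
structure IsHopfModule {M : Type u} [AddCommGroup M] [Module k M] [Module H M]
    [IsScalarTower k H M] (ρ : M →ₗ[k] M ⊗[k] C) : Prop where
  isRightCoaction : IsRightCoaction ρ
  smul : ∀ (h : H) (m : M), ρ (h • m) = diagAct k H M C (comul (R := k) h) (ρ m)

/-- The base ring `k` as an `H`-module, through the counit of `H`. -/
@[nolint unusedArguments]
def TrivialModule (k H : Type u) [CommRing k] [CommRing H] [HopfAlgebra k H] : Type u := k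

instance : AddCommGroup (TrivialModule k H) := inferInstanceAs (AddCommGroup k)
instance : Module k (TrivialModule k H) := inferInstanceAs (Module k k)
instance : Module H (TrivialModule k H) :=
  Module.compHom k (Bialgebra.counitAlgHom k H : H →+* k)

instance : IsScalarTower k H (TrivialModule k H) where
  smul_assoc r h x := by
    change counit (R := k) (r • h) * (show k from x) = r * (counit (R := k) h * (show k from x))
    rw [map_smul, smul_eq_mul]
    exact mul_assoc _ _ _

theorem smul_trivialModule (h : H) (r : k) :
    h • (show TrivialModule k H from r) = (show TrivialModule k H from counit (R := k) h * r) :=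
  rfl

/-- The functor `- ⊗_H k` from Hopf modules to `k`-modules, on objects. -/
abbrev coinv (M : Type u) [AddCommGroup M] [Module H M] : Type u :=
  M ⊗[H] TrivialModule k H

/-- The map `M → M ⊗_H k`, `m ↦ m ⊗ 1`. -/
def toCoinv (M : Type u) [AddCommGroup M] [Module k M] [Module H M] [IsScalarTower k H M] :
    M →ₗ[k] coinv k H M where
  toFun m := m ⊗ₜ (1 : k)
  map_add' m n := TensorProduct.add_tmul m n _
  map_smul' _ _ := rfl

variable {k H C} in
/-- The unit `M → (M ⊗_H k) ⊗ C`, `m ↦ (m₀ ⊗_H 1) ⊗ m₁`, of the adjunction between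
`- ⊗_H k` and `- ⊗ C`, at the Hopf module `M`. -/
def adjUnit {M : Type u} [AddCommGroup M] [Module k M] [Module H M] [IsScalarTower k H M]
    (ρ : M →ₗ[k] M ⊗[k] C) : M →ₗ[k] coinv k H M ⊗[k] C :=
  (toCoinv k H M).rTensor C ∘ₗ ρ

/-- The counit `(N ⊗ C) ⊗_H k → N`, `(n ⊗ c) ⊗_H r ↦ r ε(c) n`, of the adjunction between
`- ⊗_H k` and `- ⊗ C`, at the `k`-module `N`. The two factors of `N ⊗ C` are written in the
opposite order, so that `H` acts on the left factor. -/
def adjCounit [IsModuleCoalgebra k H C] (N : Type u) [AddCommGroup N] [Module k N] :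
    coinv k H (C ⊗[k] N) →+ N :=
  TensorProduct.liftAddHom
    (LinearMap.toAddMonoidHom'.comp ((LinearMap.lsmul k N).flip ∘ₗ
      (TensorProduct.lid k N).toLinearMap ∘ₗ
        (counit : C →ₗ[k] k).rTensor N).toAddMonoidHom : C ⊗[k] N →+ TrivialModule k H →+ N)
    (by
      intro h x (r : k)
      change r • (TensorProduct.lid k N) ((counit : C →ₗ[k] k).rTensor N (h • x)) =
        (counit (R := k) h * r) • (TensorProduct.lid k N) ((counit : C →ₗ[k] k).rTensor N x)
      induction x with
      | zero => simp
      | add x y hx hy => simp only [smul_add, map_add, hx, hy]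
      | tmul c n =>
        simp [TensorProduct.smul_tmul', IsModuleCoalgebra.counit_smul, smul_smul]
        ring_nf)

theorem adjCounit_tmul [IsModuleCoalgebra k H C] (N : Type u) [AddCommGroup N] [Module k N]
    (c : C) (n : N) (r : k) :
    adjCounit k H C N ((c ⊗ₜ n) ⊗ₜ (show TrivialModule k H from r)) =
      r • counit (R := k) c • n := rfl

/-- `C` is a Galois co-object for `H`: an `H`-module coalgebra such that the adjoint functors
`- ⊗_H k` (from `(H, C)`-Hopf modules to `k`-modules) and `- ⊗ C` are inverse equivalences, that
is, the unit and the counit of the adjunction are isomorphisms. -/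
class IsGaloisCoobject : Prop extends IsModuleCoalgebra k H C where
  unit_bijective : ∀ (M : Type u) [AddCommGroup M] [Module k M] [Module H M]
    [IsScalarTower k H M] (ρ : M →ₗ[k] M ⊗[k] C), IsHopfModule (H := H) ρ →
      Function.Bijective (adjUnit (H := H) ρ)
  counit_bijective : ∀ (N : Type u) [AddCommGroup N] [Module k N],
    Function.Bijective (adjCounit k H C N)

/-- The map `δ : C ⊗ H → C ⊗ C`, `c ⊗ h ↦ c₁ ⊗ c₂ h`. -/
def delta : C ⊗[k] H →ₗ[k] C ⊗[k] C :=
  (actL k H C ∘ₗ (TensorProduct.comm k C H).toLinearMap).lTensor C ∘ₗ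
    (TensorProduct.assoc k C C H).toLinearMap ∘ₗ (comul : C →ₗ[k] C ⊗[k] C).rTensor H

variable {k H C}

theorem delta_tmul (c : C) (h : H) :
    delta k H C (c ⊗ₜ h) = diagAct k H C C (1 ⊗ₜ h) (comul (R := k) c) := by
  simp only [delta, LinearMap.comp_apply, LinearMap.rTensor_tmul]
  generalize (comul (R := k) c) = x
  induction x with
  | zero => simp
  | add x y hx hy => simp only [TensorProduct.add_tmul, map_add, hx, hy]
  | tmul a b => simp

theorem diagAct_mul {M N : Type u} [AddCommGroup M] [Module k M] [Module H M] [IsScalarTower k H M]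
    [AddCommGroup N] [Module k N] [Module H N] [IsScalarTower k H N] (p q : H ⊗[k] H)
    (x : M ⊗[k] N) :
    diagAct k H M N (p * q) x = diagAct k H M N p (diagAct k H M N q x) := by
  induction x with
  | zero => simp
  | add x y hx hy => simp [hx, hy]
  | tmul m n =>
    induction p with
    | zero => simp
    | add x y hx hy => simp [hx, hy, add_mul]
    | tmul a b =>
      induction q with
      | zero => simp
      | add x y hx hy => simp_all [mul_add]
      | tmul c d => simp [mul_smul]

/-- The action `H ⊗ C → C` is a map of coalgebras. -/
theorem comul_actL [IsModuleCoalgebra k H C] :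
    comul ∘ₗ actL k H C = TensorProduct.map (actL k H C) (actL k H C) ∘ₗ comul (R := k) := by
  ext h c
  simp only [TensorProduct.AlgebraTensorModule.curry_apply, LinearMap.restrictScalars_self,
    TensorProduct.curry_apply, LinearMap.comp_apply, actL_tmul, IsModuleCoalgebra.comul_smul,
    TensorProduct.comul_tmul]
  generalize (comul (R := k) h) = p
  generalize (comul (R := k) c) = q
  induction p with
  | zero => simp
  | add x y hx hy => simp_all [TensorProduct.add_tmul]
  | tmul a b =>
    induction q with
    | zero => simp
    | add x y hx hy => simp_all [TensorProduct.tmul_add]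
    | tmul x y => simp

variable (k H C) in
/-- The coaction `h ⊗ c ↦ (h₁ ⊗ c₁) ⊗ c₂ h₂` of `C` on `H ⊗ C`. -/
def freeCoaction : H ⊗[k] C →ₗ[k] (H ⊗[k] C) ⊗[k] C :=
  (actL k H C).lTensor (H ⊗[k] C) ∘ₗ comul

theorem isHopfModule_freeCoaction [IsModuleCoalgebra k H C] :
    IsHopfModule (H := H) (freeCoaction k H C) := by
  refine ⟨⟨?_, ?_⟩, ?_⟩
  · have h1 : (TensorProduct.assoc k (H ⊗[k] C) C C).toLinearMap ∘ₗ
        (freeCoaction k H C).rTensor C ∘ₗ (actL k H C).lTensor (H ⊗[k] C) =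
        (TensorProduct.map (actL k H C) (actL k H C)).lTensor (H ⊗[k] C) ∘ₗ
        (TensorProduct.assoc k (H ⊗[k] C) (H ⊗[k] C) (H ⊗[k] C)).toLinearMap ∘ₗ
          (comul : H ⊗[k] C →ₗ[k] _).rTensor (H ⊗[k] C) := by
      refine TensorProduct.ext' fun a b => ?_
      simp only [freeCoaction, LinearMap.comp_apply, LinearMap.lTensor_tmul,
        LinearMap.rTensor_tmul]
      generalize (comul (R := k) a) = x
      induction x with
      | zero => simp
      | add x y hx hy => simp only [TensorProduct.add_tmul, map_add, hx, hy]
      | tmul u v => simp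
    calc _ = ((TensorProduct.assoc k (H ⊗[k] C) C C).toLinearMap ∘ₗ
        (freeCoaction k H C).rTensor C ∘ₗ (actL k H C).lTensor (H ⊗[k] C)) ∘ₗ comul := rfl
      _ = (TensorProduct.map (actL k H C) (actL k H C)).lTensor (H ⊗[k] C) ∘ₗ
          (TensorProduct.assoc k (H ⊗[k] C) (H ⊗[k] C) (H ⊗[k] C)).toLinearMap ∘ₗ
          (comul : H ⊗[k] C →ₗ[k] _).rTensor (H ⊗[k] C) ∘ₗ comul := by rw [h1]; rfl
      _ = (TensorProduct.map (actL k H C) (actL k H C) ∘ₗ comul).lTensor (H ⊗[k] C) ∘ₗ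
          comul := by rw [Coalgebra.coassoc, LinearMap.lTensor_comp]; rfl
      _ = _ := by rw [← comul_actL, LinearMap.lTensor_comp]; rfl
  · have h1 : (counit : C →ₗ[k] k) ∘ₗ actL k H C = counit := by
      refine TensorProduct.ext' fun a b => ?_
      simp [IsModuleCoalgebra.counit_smul, mul_comm]
    rw [freeCoaction, ← LinearMap.comp_assoc, ← LinearMap.lTensor_comp, h1,
      Coalgebra.lTensor_counit_comp_comul]
  · intro g x
    induction x with
    | zero => simp
    | add x y hx hy => simp_all
    | tmul h c =>
      simp only [freeCoaction, LinearMap.comp_apply, TensorProduct.smul_tmul', smul_eq_mul,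
        TensorProduct.comul_tmul, Bialgebra.comul_mul]
      generalize (comul (R := k) g) = p
      generalize (comul (R := k) h) = q
      generalize (comul (R := k) c) = r
      induction p with
      | zero => simp
      | add x y hx hy => simp_all [TensorProduct.add_tmul, add_mul]
      | tmul p p' =>
        induction q with
        | zero => simp
        | add x y hx hy => simp_all [TensorProduct.add_tmul, mul_add]
        | tmul q q' =>
          induction r with
          | zero => simp
          | add x y hx hy => simp_all [TensorProduct.tmul_add]
          | tmul r r' => simp [mul_smul, TensorProduct.smul_tmul']

variable (k H C) in
/-- The map `C → (H ⊗ C) ⊗_H k`, `c ↦ (1 ⊗ c) ⊗ 1`. -/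
def toCoinvFree : C →ₗ[k] coinv k H (H ⊗[k] C) :=
  toCoinv k H (H ⊗[k] C) ∘ₗ TensorProduct.mk k H C 1

theorem toCoinv_tmul (h : H) (c : C) :
    toCoinv k H (H ⊗[k] C) (h ⊗ₜ c) = counit (R := k) h • toCoinvFree k H C c := by
  have h1 : (h ⊗ₜ[k] c : H ⊗[k] C) = h • ((1 : H) ⊗ₜ[k] c) := by
    simp [TensorProduct.smul_tmul']
  have h2 : h • (show TrivialModule k H from (1 : k)) =
      counit (R := k) h • (show TrivialModule k H from (1 : k)) := rfl
  rw [h1]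
  change (h • ((1 : H) ⊗ₜ[k] c)) ⊗ₜ[H] (show TrivialModule k H from (1 : k)) = _
  rw [TensorProduct.smul_tmul, h2, TensorProduct.tmul_smul]
  rfl

variable (k H C) in
theorem toCoinvFree_bijective : Function.Bijective (toCoinvFree k H C) := by
  constructor
  · let f : H ⊗[k] C →ₗ[k] C :=
      (TensorProduct.lid k C).toLinearMap ∘ₗ (counit : H →ₗ[k] k).rTensor C
    let g : coinv k H (H ⊗[k] C) →+ C := TensorProduct.liftAddHom
      (LinearMap.toAddMonoidHom'.comp ((LinearMap.lsmul k C).flip ∘ₗ f).toAddMonoidHom :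
        H ⊗[k] C →+ TrivialModule k H →+ C)
      (by
        intro h x (r : k)
        change r • f (h • x) = (counit (R := k) h * r) • f x
        induction x with
        | zero => simp
        | add x y hx hy => simp only [smul_add, map_add, hx, hy]
        | tmul a c =>
          simp [f, TensorProduct.smul_tmul', smul_smul]
          ring_nf)
    have hg : ∀ c, g (toCoinvFree k H C c) = c := by
      intro c
      change (1 : k) • f ((1 : H) ⊗ₜ c) = c
      simp [f]
    intro a b hab
    rw [← hg a, ← hg b, hab]
  · intro x
    induction x using TensorProduct.induction_on with
    | zero => exact ⟨0, map_zero _⟩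
    | add x y hx hy =>
      obtain ⟨a, rfl⟩ := hx
      obtain ⟨b, rfl⟩ := hy
      exact ⟨a + b, map_add _ _ _⟩
    | tmul x r =>
      have h1 : x ⊗ₜ[H] r = (show k from r) • toCoinv k H (H ⊗[k] C) x := by
        change _ = (show k from r) • (x ⊗ₜ[H] (show TrivialModule k H from (1 : k)))
        rw [← TensorProduct.tmul_smul]
        congr 1
        exact (mul_one (show k from r)).symm
      rw [h1]
      clear h1
      induction x with
      | zero => exact ⟨0, by rw [map_zero, map_zero, smul_zero]⟩
      | add x y hx hy =>
        obtain ⟨a, ha⟩ := hx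
        obtain ⟨b, hb⟩ := hy
        exact ⟨a + b, by rw [map_add, map_add, smul_add, ha, hb]⟩
      | tmul h c =>
        exact ⟨(show k from r) • counit (R := k) h • c, by rw [toCoinv_tmul, map_smul, map_smul]⟩

/-- For a Galois co-object, the map `δ` is bijective. -/
theorem delta_bijective [IsGaloisCoobject k H C] : Function.Bijective (delta k H C) := by
  have h1 := IsGaloisCoobject.unit_bijective (k := k) (H := H) (C := C) _ (freeCoaction k H C)
    isHopfModule_freeCoaction
  let e := LinearEquiv.ofBijective _ (toCoinvFree_bijective k H C)
  have h2 : adjUnit (H := H) (freeCoaction k H C) =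
      (e.rTensor C).toLinearMap ∘ₗ delta k H C ∘ₗ (TensorProduct.comm k H C).toLinearMap := by
    refine TensorProduct.ext' fun h c => ?_
    have h3 : (e.rTensor C).toLinearMap = (toCoinvFree k H C).rTensor C := rfl
    have h4 : ∀ (p : H ⊗[k] H) (q : C ⊗[k] C),
        (toCoinv k H (H ⊗[k] C)).rTensor C ((actL k H C).lTensor (H ⊗[k] C)
          (TensorProduct.tensorTensorTensorComm k H H C C (p ⊗ₜ q))) =
        (toCoinvFree k H C).rTensor C (diagAct k H C C
          (1 ⊗ₜ TensorProduct.lid k H ((counit : H →ₗ[k] k).rTensor H p)) q) := by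
      intro p q
      induction p with
      | zero => simp
      | add x y hx hy =>
        simp only [TensorProduct.add_tmul, TensorProduct.tmul_add, map_add, hx, hy,
          LinearMap.add_apply]
      | tmul a b =>
        induction q with
        | zero => simp
        | add x y hx hy => simp_all [TensorProduct.tmul_add]
        | tmul x y =>
          simp only [TensorProduct.tensorTensorTensorComm_tmul, LinearMap.lTensor_tmul,
            LinearMap.rTensor_tmul, actL_tmul, toCoinv_tmul, TensorProduct.lid_tmul,
            diagAct_tmul, one_smul, smul_assoc, TensorProduct.smul_tmul]
    have h5 := h4 (comul (R := k) h) (comul (R := k) c)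
    rw [Coalgebra.rTensor_counit_comul, TensorProduct.lid_tmul, one_smul] at h5
    simp only [adjUnit, freeCoaction, LinearMap.comp_apply, h3, LinearEquiv.coe_coe,
      TensorProduct.comm_tmul, delta_tmul, TensorProduct.comul_tmul]
    exact h5
  rw [h2] at h1
  have h3 : delta k H C = (e.rTensor C).symm.toLinearMap ∘ₗ
      ((e.rTensor C).toLinearMap ∘ₗ delta k H C ∘ₗ (TensorProduct.comm k H C).toLinearMap) ∘ₗ
        (TensorProduct.comm k H C).symm.toLinearMap := by
    refine LinearMap.ext fun x => ?_
    rw [LinearMap.comp_apply, LinearMap.comp_apply, LinearMap.comp_apply, LinearMap.comp_apply,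
      LinearEquiv.coe_coe, LinearEquiv.coe_coe, LinearEquiv.coe_coe, LinearEquiv.coe_coe,
      LinearEquiv.symm_apply_apply, LinearEquiv.apply_symm_apply]
  rw [h3]
  exact (e.rTensor C).symm.bijective.comp (h1.comp (TensorProduct.comm k H C).symm.bijective)

/-- The map `δ` of a Galois co-object, as an isomorphism. -/
def deltaEquiv (k H C : Type u) [CommRing k] [CommRing H] [HopfAlgebra k H]
    [AddCommGroup C] [Module k C] [Coalgebra k C] [Module H C] [IsScalarTower k H C]
    [IsGaloisCoobject k H C] : C ⊗[k] H ≃ₗ[k] C ⊗[k] C :=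
  LinearEquiv.ofBijective (delta k H C) delta_bijective

/-- The map `(ε_C ⊗ H) ∘ δ⁻¹ : C ⊗ C → H`. -/
def cotranslation (k H C : Type u) [CommRing k] [CommRing H] [HopfAlgebra k H]
    [AddCommGroup C] [Module k C] [Coalgebra k C] [Module H C] [IsScalarTower k H C]
    [IsGaloisCoobject k H C] : C ⊗[k] C →ₗ[k] H :=
  (TensorProduct.lid k H).toLinearMap ∘ₗ (counit : C →ₗ[k] k).rTensor H ∘ₗ
    (deltaEquiv k H C).symm.toLinearMap

section Cotranslation

variable [IsGaloisCoobject k H C]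

theorem cotranslation_delta (c : C) (h : H) :
    cotranslation k H C (diagAct k H C C (1 ⊗ₜ h) (comul (R := k) c)) =
      counit (R := k) c • h := by
  have h1 : (deltaEquiv k H C).symm (diagAct k H C C (1 ⊗ₜ h) (comul (R := k) c)) = c ⊗ₜ h := by
    rw [LinearEquiv.symm_apply_eq, ← delta_tmul]
    rfl
  simp [cotranslation, h1]

theorem delta_induction {P : C ⊗[k] C → Prop} (h0 : P 0) (hadd : ∀ x y, P x → P y → P (x + y))
    (h : ∀ (c : C) (g : H), P (diagAct k H C C (1 ⊗ₜ g) (comul (R := k) c))) (x : C ⊗[k] C) :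
    P x := by
  obtain ⟨y, rfl⟩ := (deltaEquiv k H C).surjective x
  induction y with
  | zero => simpa using h0
  | add x y hx hy => rw [map_add]; exact hadd _ _ hx hy
  | tmul c g => exact (delta_tmul (k := k) c g) ▸ h c g

theorem cotranslation_comul (c : C) :
    cotranslation k H C (comul (R := k) c) = counit (R := k) c • 1 := by
  rw [← cotranslation_delta]
  congr 1
  generalize (comul (R := k) c) = x
  induction x with
  | zero => simp
  | add x y hx hy => rw [map_add, ← hx, ← hy]
  | tmul a b => simp

theorem cotranslation_right (h : H) (x : C ⊗[k] C) :
    cotranslation k H C (diagAct k H C C (1 ⊗ₜ h) x) = cotranslation k H C x * h := by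
  refine delta_induction (k := k) (H := H) (P := fun x => cotranslation k H C
      (diagAct k H C C (1 ⊗ₜ h) x) = cotranslation k H C x * h) (by simp)
    (fun x y hx hy => by simp [hx, hy, add_mul]) (fun c g => ?_) x
  · rw [← diagAct_mul, Algebra.TensorProduct.tmul_mul_tmul, one_mul, cotranslation_delta,
      cotranslation_delta, smul_mul_assoc, mul_comm h g]

theorem cotranslation_left (h : H) (x : C ⊗[k] C) :
    cotranslation k H C (diagAct k H C C (h ⊗ₜ 1) x) =
      antipode k h * cotranslation k H C x := by
  refine delta_induction (k := k) (H := H) (P := fun x => cotranslation k H C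
      (diagAct k H C C (h ⊗ₜ 1) x) = antipode k h * cotranslation k H C x) (by simp)
    (fun x y hx hy => by simp [hx, hy, mul_add]) (fun c g => ?_) x
  · -- `h c₁ ⊗ c₂ g = δ (h₁ c ⊗ S(h₂) g)`
    rw [cotranslation_right, cotranslation_comul, ← diagAct_mul,
      Algebra.TensorProduct.tmul_mul_tmul, mul_one, one_mul]
    have h1 : ∀ p : H ⊗[k] H,
        cotranslation k H C (diagAct k H C C
          ((TensorProduct.map .id (LinearMap.mul' k H)) ((TensorProduct.assoc k H H H)
            (TensorProduct.map comul (antipode k) p)) * (1 ⊗ₜ g)) (comul (R := k) c)) =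
        counit (R := k) c • (TensorProduct.lid k H ((counit : H →ₗ[k] k).rTensor H
          ((antipode k).lTensor H p)) * g) := by
      intro p
      induction p with
      | zero => simp
      | add x y hx hy =>
        simp only [map_add, add_mul, smul_add, LinearMap.add_apply, hx, hy]
      | tmul a b =>
        have h2 : (TensorProduct.map .id (LinearMap.mul' k H)) ((TensorProduct.assoc k H H H)
            (comul (R := k) a ⊗ₜ antipode k b)) = (1 ⊗ₜ antipode k b) * comul (R := k) a := by
          generalize (comul (R := k) a) = q
          induction q with
          | zero => simp
          | add x y hx hy => simp only [TensorProduct.add_tmul, map_add, mul_add, hx, hy]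
          | tmul x y => simp [mul_comm]
        rw [TensorProduct.map_tmul, h2, mul_right_comm, Algebra.TensorProduct.tmul_mul_tmul,
          one_mul, diagAct_mul, ← IsModuleCoalgebra.comul_smul, cotranslation_delta,
          IsModuleCoalgebra.counit_smul]
        simp [mul_smul, smul_comm (counit (R := k) a) (counit (R := k) c)]
    have h3 := h1 (comul h)
    have h4 : (TensorProduct.map .id (LinearMap.mul' k H)) ((TensorProduct.assoc k H H H)
            (TensorProduct.map comul (antipode k) (comul (R := k) h))) = h ⊗ₜ 1 := by
      have e1 : TensorProduct.map (comul (R := k)) (antipode k) (comul (R := k) h) =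
          (antipode k).lTensor (H ⊗[k] H)
            ((comul : H →ₗ[k] H ⊗[k] H).rTensor H (comul (R := k) h)) := by
        generalize (comul (R := k) h) = t
        induction t with
        | zero => simp
        | add x y hx hy => simp only [map_add, hx, hy]
        | tmul a b => simp
      have e2 : ∀ t : (H ⊗[k] H) ⊗[k] H, TensorProduct.assoc k H H H
          ((antipode k).lTensor (H ⊗[k] H) t) =
            ((antipode k).lTensor H).lTensor H (TensorProduct.assoc k H H H t) := by
        intro t
        rw [← LinearEquiv.coe_coe, ← LinearMap.comp_apply, ← LinearMap.comp_apply]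
        congr 1
        ext x y z
        simp
      rw [e1, e2, Coalgebra.coassoc_apply]
      change (LinearMap.mul' k H).lTensor H _ = _
      rw [← LinearMap.comp_apply, ← LinearMap.comp_apply, ← LinearMap.lTensor_comp,
        ← LinearMap.lTensor_comp, LinearMap.comp_assoc, HopfAlgebra.mul_antipode_lTensor_comul, LinearMap.lTensor_comp,
        LinearMap.comp_apply, Coalgebra.lTensor_counit_comul]
      simp
    have h5 : TensorProduct.lid k H ((counit : H →ₗ[k] k).rTensor H
          ((antipode k).lTensor H (comul h))) = antipode k h := by
      rw [← LinearMap.comp_apply, LinearMap.rTensor_comp_lTensor,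
        ← LinearMap.lTensor_comp_rTensor, LinearMap.comp_apply, Coalgebra.rTensor_counit_comul]
      simp
    rw [h4, h5] at h3
    rw [Algebra.TensorProduct.tmul_mul_tmul, mul_one, one_mul] at h3
    rw [h3]
    simp

/-- The compatibility of the two evaluations: `S(ev(x ⊗ y)) z = ev(y ⊗ z) x`. -/
theorem antipode_cotranslation_smul (x y z : C) :
    antipode k (cotranslation k H C (x ⊗ₜ y)) • z = cotranslation k H C (y ⊗ₜ z) • x := by
  let Q : (C ⊗[k] C) ⊗[k] C →ₗ[k] C :=
    actL k H C ∘ₗ (antipode k ∘ₗ cotranslation k H C).rTensor C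
  let P : C ⊗[k] (C ⊗[k] C) →ₗ[k] C :=
    actL k H C ∘ₗ (TensorProduct.comm k C H).toLinearMap ∘ₗ (cotranslation k H C).lTensor C
  let a := (TensorProduct.assoc k C C C).symm
  have hQ : ∀ (p : H ⊗[k] H) (w : C) (v : C ⊗[k] C),
      Q (a (w ⊗ₜ diagAct k H C C p v)) =
        LinearMap.mul' k H ((antipode k).rTensor H p) • Q (a (w ⊗ₜ v)) := by
    intro p w v
    induction v with
    | zero => simp
    | add u v hu hv => simp only [map_add, TensorProduct.tmul_add, hu, hv, smul_add]
    | tmul c d =>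
      induction p with
      | zero => simp
      | add u v hu hv =>
        simp only [map_add, LinearMap.add_apply, TensorProduct.tmul_add, hu, hv, add_smul]
      | tmul g h =>
        have h1 : cotranslation k H C (w ⊗ₜ[k] (g • c)) =
            cotranslation k H C (w ⊗ₜ[k] c) * g := by
          rw [← cotranslation_right, diagAct_tmul, one_smul]
        simp only [a, Q, diagAct_tmul, TensorProduct.assoc_symm_tmul, LinearMap.comp_apply,
          LinearMap.rTensor_tmul, actL_tmul, h1, antipode_mul_distrib, LinearMap.mul'_apply,
          smul_smul]
        ring_nf
  have hR1 : ∀ (g : H) (t : C ⊗[k] C),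
      Q (a ((comul : C →ₗ[k] _).lTensor C (diagAct k H C C (1 ⊗ₜ g) t))) =
        counit (R := k) g • Q (a ((comul : C →ₗ[k] _).lTensor C t)) := by
    intro g t
    induction t with
    | zero => simp
    | add u v hu hv => simp only [map_add, hu, hv, smul_add]
    | tmul c d =>
      rw [diagAct_tmul, LinearMap.lTensor_tmul, one_smul, IsModuleCoalgebra.comul_smul, hQ,
        HopfAlgebra.mul_antipode_rTensor_comul_apply, algebraMap_smul, LinearMap.lTensor_tmul]
  have hR2 : ∀ c : C, Q (a ((comul : C →ₗ[k] _).lTensor C (comul (R := k) c))) = c := by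
    intro c
    have h1 : Q ∘ₗ (comul : C →ₗ[k] _).rTensor C =
        (TensorProduct.lid k C).toLinearMap ∘ₗ (counit : C →ₗ[k] k).rTensor C := by
      refine TensorProduct.ext' fun c d => ?_
      simp [Q, cotranslation_comul, antipode_one]
    rw [Coalgebra.coassoc_symm_apply, ← LinearMap.comp_apply, h1, LinearMap.comp_apply,
      Coalgebra.rTensor_counit_comul]
    simp
  have hR : ∀ t : C ⊗[k] C, Q (a ((comul : C →ₗ[k] _).lTensor C t)) =
      TensorProduct.rid k C ((counit : C →ₗ[k] k).lTensor C t) := by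
    intro t
    refine delta_induction (k := k) (H := H) (P := fun t =>
      Q (a ((comul : C →ₗ[k] _).lTensor C t)) =
        TensorProduct.rid k C ((counit : C →ₗ[k] k).lTensor C t)) (by simp)
      (fun x y hx hy => by simp only [map_add, hx, hy]) (fun c g => ?_) t
    have h1 : ∀ u : C ⊗[k] C, TensorProduct.rid k C ((counit : C →ₗ[k] k).lTensor C
        (diagAct k H C C (1 ⊗ₜ g) u)) =
        counit (R := k) g • TensorProduct.rid k C ((counit : C →ₗ[k] k).lTensor C u) := by
      intro u
      induction u with
      | zero => simp
      | add u v hu hv => simp only [map_add, hu, hv, smul_add]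
      | tmul c d => simp [IsModuleCoalgebra.counit_smul, mul_smul]
    rw [hR1, hR2, h1, Coalgebra.lTensor_counit_comul, TensorProduct.rid_tmul, one_smul]
  have hPQ : ∀ u : C ⊗[k] C, Q (a (x ⊗ₜ u)) = P (x ⊗ₜ u) := by
    intro u
    refine delta_induction (k := k) (H := H) (P := fun u => Q (a (x ⊗ₜ u)) = P (x ⊗ₜ u))
      (by simp) (fun u v hu hv => by simp only [map_add, TensorProduct.tmul_add, hu, hv])
      (fun c g => ?_) u
    have h1 : LinearMap.mul' k H ((antipode k).rTensor H ((1 : H) ⊗ₜ[k] g)) = g := by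
      simp [antipode_one]
    have h2 := hR (x ⊗ₜ c)
    rw [LinearMap.lTensor_tmul, LinearMap.lTensor_tmul, TensorProduct.rid_tmul] at h2
    rw [hQ, h1, h2]
    simp [P, cotranslation_delta, smul_comm g]
  exact hPQ (y ⊗ₜ z)

end Cotranslation

theorem antipode_antipode (h : H) : antipode k (antipode k h) = h := by
  have h1 : (WithConv.toConv (AlgHom.id k H))⁻¹⁻¹ = WithConv.toConv (AlgHom.id k H) := inv_inv _
  exact DFunLike.congr_fun (congrArg WithConv.ofConv h1) h

/-! ### The herd of a Galois co-object -/

variable (k H C) in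
/-- The `k`-module `C` with the `H`-action `h ⇀ c = c S⁻¹(h)`; as `H` is commutative, its antipode
is involutive, that is `S⁻¹ = S`. It is an `H`-bimodule with the same left and right action. -/
@[nolint unusedArguments]
def Hat (k H C : Type u) [CommRing k] [CommRing H] [HopfAlgebra k H] [AddCommGroup C]
    [Module k C] [Module H C] : Type u := C

section HatInstances

instance : AddCommGroup (Hat k H C) := inferInstanceAs (AddCommGroup C)
instance : Module k (Hat k H C) := inferInstanceAs (Module k C)
instance : Module H (Hat k H C) := Module.compHom C (antipodeAlgHom k H : H →+* H)
instance : Module Hᵐᵒᵖ (Hat k H C) :=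
  Module.compHom C ((antipodeAlgHom k H : H →+* H).comp
    ((RingEquiv.toOpposite H).symm : Hᵐᵒᵖ →+* H))

variable (k H C) in
/-- The identification of the `k`-modules `C` and `Hat k H C`. -/
def toHat : C ≃ₗ[k] Hat k H C := LinearEquiv.refl k C

theorem smul_toHat (h : H) (c : C) : h • toHat k H C c = toHat k H C (antipode k h • c) := rfl

theorem op_smul_toHat (h : H) (c : C) :
    op h • toHat k H C c = toHat k H C (antipode k h • c) := rfl

instance : SMulCommClass H Hᵐᵒᵖ (Hat k H C) where
  smul_comm g h c := smul_comm (antipode k g) (antipode k h.unop) (show C from c)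

instance : IsScalarTower k H (Hat k H C) where
  smul_assoc r h c := by
    change antipode k (r • h) • (show C from c) = r • antipode k h • (show C from c)
    rw [map_smul, smul_assoc]

instance : IsScalarTower k Hᵐᵒᵖ (Hat k H C) where
  smul_assoc r h c := by
    change antipode k (r • h.unop) • (show C from c) = r • antipode k h.unop • (show C from c)
    rw [map_smul, smul_assoc]

end HatInstances

variable (k H C) in
/-- The herd of a Galois co-object `C`: the `H`-bimodule `C` (with the same left and right action)
with pen `Hat k H C`, evaluations `ev = (ε_C ⊗ H) ∘ δ⁻¹` and `S ∘ ev`, and shepherd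
`Δ² = (C ⊗ Δ) ∘ Δ`. -/
def herd [Module Hᵐᵒᵖ C] [IsCentralScalar H C] [IsGaloisCoobject k H C] :
    Herd k H H C (Hat k H C) where
  ev := cotranslation k H C ∘ₗ (toHat k H C).symm.toLinearMap.rTensor C
  evHat := antipode k ∘ₗ cotranslation k H C ∘ₗ (toHat k H C).symm.toLinearMap.lTensor C
  γ := ((toHat k H C).toLinearMap.rTensor C).lTensor C ∘ₗ (comul : C →ₗ[k] _).lTensor C ∘ₗ comul
  ev_left a y x := by
    obtain ⟨y, rfl⟩ := (toHat k H C).surjective y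
    have := cotranslation_left (k := k) (antipode k a) (y ⊗ₜ[k] x)
    rw [antipode_antipode] at this
    simpa [smul_toHat] using this
  ev_right a y x := by
    obtain ⟨y, rfl⟩ := (toHat k H C).surjective y
    have := cotranslation_right (k := k) a (y ⊗ₜ[k] x)
    simpa using this
  evHat_left b x y := by
    obtain ⟨y, rfl⟩ := (toHat k H C).surjective y
    have := congrArg (antipode k) (cotranslation_left (k := k) b (x ⊗ₜ[k] y))
    rw [antipode_mul_distrib, antipode_antipode] at this
    simpa using this
  evHat_right b x y := by
    obtain ⟨y, rfl⟩ := (toHat k H C).surjective y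
    have := congrArg (antipode k) (cotranslation_right (k := k) (antipode k b) (x ⊗ₜ[k] y))
    rw [antipode_mul_distrib, antipode_antipode] at this
    simpa [op_smul_toHat] using this
  evHat_smul x y x' := by
    obtain ⟨y, rfl⟩ := (toHat k H C).surjective y
    simpa using antipode_cotranslation_smul (k := k) (H := H) x y x'
  smul_evHat y x y' := by
    obtain ⟨y, rfl⟩ := (toHat k H C).surjective y
    obtain ⟨y', rfl⟩ := (toHat k H C).surjective y'
    have := antipode_cotranslation_smul (k := k) (H := H) y x y'
    simp only [LinearMap.comp_apply, LinearMap.lTensor_tmul, LinearMap.rTensor_tmul,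
      LinearEquiv.coe_coe, LinearEquiv.symm_apply_apply, op_smul_toHat, smul_toHat,
      antipode_antipode]
    rw [← this]
  evHat_γ x := by
    have h1 : ∀ u : C ⊗[k] (C ⊗[k] C),
        (antipode k ∘ₗ cotranslation k H C ∘ₗ
          (toHat k H C).symm.toLinearMap.lTensor C).rTensor C
          ((TensorProduct.assoc k C (Hat k H C) C).symm
            (((toHat k H C).toLinearMap.rTensor C).lTensor C u)) =
        (antipode k ∘ₗ cotranslation k H C).rTensor C ((TensorProduct.assoc k C C C).symm u) := by
      intro u
      rw [← LinearEquiv.coe_coe, ← LinearEquiv.coe_coe, ← LinearMap.comp_apply,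
        ← LinearMap.comp_apply, ← LinearMap.comp_apply]
      congr 1
      ext a b c
      simp
    have h2 : (antipode k ∘ₗ cotranslation k H C).rTensor C ∘ₗ (comul : C →ₗ[k] _).rTensor C =
        (Algebra.linearMap k H).rTensor C ∘ₗ (counit : C →ₗ[k] k).rTensor C := by
      refine TensorProduct.ext' fun a b => ?_
      simp [cotranslation_comul, antipode_one, Algebra.algebraMap_eq_smul_one]
    rw [LinearMap.comp_apply, h1, LinearMap.comp_apply, Coalgebra.coassoc_symm_apply,
      ← LinearMap.comp_apply, h2, LinearMap.comp_apply, Coalgebra.rTensor_counit_comul]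
    simp
  ev_γ x := by
    have h1 : (cotranslation k H C ∘ₗ (toHat k H C).symm.toLinearMap.rTensor C).lTensor C ∘ₗ
        ((toHat k H C).toLinearMap.rTensor C).lTensor C ∘ₗ (comul : C →ₗ[k] _).lTensor C =
        (Algebra.linearMap k H).lTensor C ∘ₗ (counit : C →ₗ[k] k).lTensor C := by
      refine TensorProduct.ext' fun a b => ?_
      have h2 : ∀ t : C ⊗[k] C, (toHat k H C).symm.toLinearMap.rTensor C
          ((toHat k H C).toLinearMap.rTensor C t) = t := by
        intro t
        rw [← LinearMap.comp_apply, ← LinearMap.rTensor_comp]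
        simp
      simp only [LinearMap.comp_apply, LinearMap.lTensor_tmul, h2, cotranslation_comul]
      simp [Algebra.algebraMap_eq_smul_one]
    have h3 := LinearMap.congr_fun h1 (comul (R := k) x)
    rw [LinearMap.comp_apply, LinearMap.comp_apply, LinearMap.comp_apply,
      Coalgebra.lTensor_counit_comul] at h3
    refine h3.trans ?_
    simp
  coassoc_γ x := by
    let j := ((toHat k H C).toLinearMap.rTensor C).lTensor C
    let J := (TensorProduct.map (toHat k H C).toLinearMap j).lTensor C
    let D : C →ₗ[k] C ⊗[k] (C ⊗[k] C) := (comul : C →ₗ[k] _).lTensor C ∘ₗ comul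
    have hl : ∀ u : C ⊗[k] (C ⊗[k] C),
        (TensorProduct.assoc k (Hat k H C) C (Hat k H C ⊗[k] C)).toLinearMap.lTensor C
          (TensorProduct.assoc k C (Hat k H C ⊗[k] C) (Hat k H C ⊗[k] C)
            ((j ∘ₗ D).rTensor (Hat k H C ⊗[k] C) (j u))) =
        J ((TensorProduct.assoc k C C (C ⊗[k] C)).toLinearMap.lTensor C
          (TensorProduct.assoc k C (C ⊗[k] C) (C ⊗[k] C) (D.rTensor (C ⊗[k] C) u))) := by
      intro u
      induction u with
      | zero => simp
      | add u v hu hv => simp only [map_add, hu, hv]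
      | tmul a v =>
        induction v with
        | zero => simp
        | add u v hu hv => simp only [map_add, TensorProduct.tmul_add, hu, hv]
        | tmul b c =>
          have h1 : j (a ⊗ₜ (b ⊗ₜ c)) = a ⊗ₜ (toHat k H C b ⊗ₜ c) := rfl
          rw [h1, LinearMap.rTensor_tmul, LinearMap.rTensor_tmul, LinearMap.comp_apply]
          generalize D a = t
          induction t with
          | zero => simp
          | add u v hu hv => simp only [map_add, TensorProduct.add_tmul, hu, hv]
          | tmul p t =>
            induction t with
            | zero => simp
            | add u v hu hv =>
              simp only [map_add, TensorProduct.tmul_add, TensorProduct.add_tmul, hu, hv]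
            | tmul q r => simp [j, J]
    have hr : ∀ u : C ⊗[k] (C ⊗[k] C),
        ((j ∘ₗ D).lTensor (Hat k H C)).lTensor C (j u) = J ((D.lTensor C).lTensor C u) := by
      intro u
      induction u with
      | zero => simp
      | add u v hu hv => simp only [map_add, hu, hv]
      | tmul a v =>
        induction v with
        | zero => simp
        | add u v hu hv => simp only [map_add, TensorProduct.tmul_add, hu, hv]
        | tmul b c => simp [j, J]
    have hD : (TensorProduct.assoc k C C (C ⊗[k] C)).toLinearMap.lTensor C
          (TensorProduct.assoc k C (C ⊗[k] C) (C ⊗[k] C) (D.rTensor (C ⊗[k] C) (D x))) =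
        (D.lTensor C).lTensor C (D x) := by
      have h1 : (TensorProduct.assoc k C C (C ⊗[k] C)).toLinearMap.lTensor C ∘ₗ
          (TensorProduct.assoc k C (C ⊗[k] C) (C ⊗[k] C)).toLinearMap ∘ₗ
            D.rTensor (C ⊗[k] C) ∘ₗ D = (D.lTensor C).lTensor C ∘ₗ D := by
        simp only [D, coassoc_simps]
      exact LinearMap.congr_fun h1 x
    refine (hl (D x)).trans ?_
    rw [hD]
    exact (hr (D x)).symm

end HopfModules
end GaloisCoobject

end

noncomputable section

/-! Under the identification of the pen with `C`, every structure map of the herd becomes an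
iterated coproduct, and the two evaluations restrict to the counit along `Δ`. These facts are
isolated in `IsCoalgebraic`; with the herd axioms they turn `C` into a coherd over itself.

The key identity is `ev(y ⊗ x₁) x₂ ⊗ x₃ = y evHat(x₁ ⊗ x₂) ⊗ x₃ = y ⊗ x` (`ev_smul_comul`). For a
tensor in `E`, summed over `y ⊗ x`, a counit on the pen leg of the equaliser condition gives `ev(y ⊗
x₁) ⊗ x₂ = 1 ⊗ ε(y) x`. Inserted in the identity, this yields `y ⊗ x = Δ(ε(y) x)`. So `Δ` maps `C`
isomorphically onto `E`, with a contraction by `ε` as inverse. The mirror argument gives `F`, and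
two comparisons by counits show that the companion is the image of the threefold coproduct. All
these inclusions are split by counits, so they remain injective after tensoring. Hence the coalgebra
structures on `E` and `F`, and the maps `cov` and `covBar` of any associated coherd, are forced to
be transports of `Δ`.

On the copy of `C` inside the companion, the structure map collapses: `evHat(x ⊗ c₁) c₂ ev(c₃ ⊗ z) =
x ev(c₁ ⊗ c₂) ev(c₃ ⊗ z) = x ev(c ⊗ z)`. The product of `c ⊗ x` with a tensor `v` is then `c ⊗ x
ev(v)`, so `ev` is multiplicative and `v` acts only through `ev(v)`. An element of counit one shows
that the coequaliser relations are exactly the kernel of `ev`; since `ev` is onto, the quotient is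
`H`. The same holds for `B'` with `evHat`.

The Galois property enters through `δ`, which defines `ev`, and through the adjunction at `N = k`,
which supplies an element of counit one. That element also makes `ev` surjective and upgrades
flatness to faithful flatness. -/

namespace BimoduleHerd

/-! ### Coassociativity and counit identities, and transport of coalgebra structures -/

section Transport

variable {k : Type u} [CommRing k] {X : Type u} [AddCommGroup X] [Module k X] [Coalgebra k X]

/-- Coassociativity with an arbitrary linear map on each leg. Since the legs are later sent to `T`,
the pen, `E`, `F` or the companion, this one form, with its two counit analogues below, covers the
coaction and bicomodule axioms. -/
theorem assoc_map_map_comul {N₁ N₂ N₃ : Type u} [AddCommGroup N₁] [Module k N₁]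
    [AddCommGroup N₂] [Module k N₂] [AddCommGroup N₃] [Module k N₃]
    (f₁ : X →ₗ[k] N₁) (f₂ : X →ₗ[k] N₂) (f₃ : X →ₗ[k] N₃) (c : X) :
    TensorProduct.assoc k N₁ N₂ N₃
        (TensorProduct.map (TensorProduct.map f₁ f₂ ∘ₗ comul) f₃ (comul (R := k) c)) =
      TensorProduct.map f₁ (TensorProduct.map f₂ f₃ ∘ₗ comul) (comul (R := k) c) := by
  have h1 : TensorProduct.map (TensorProduct.map f₁ f₂ ∘ₗ comul (R := k)) f₃ =
      TensorProduct.map (TensorProduct.map f₁ f₂) f₃ ∘ₗ comul.rTensor X := by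
    rw [LinearMap.rTensor, ← TensorProduct.map_comp, LinearMap.comp_id]
  have h2 : TensorProduct.map f₁ (TensorProduct.map f₂ f₃ ∘ₗ comul (R := k)) =
      TensorProduct.map f₁ (TensorProduct.map f₂ f₃) ∘ₗ comul.lTensor X := by
    rw [LinearMap.lTensor, ← TensorProduct.map_comp, LinearMap.comp_id]
  rw [h1, h2, LinearMap.comp_apply, LinearMap.comp_apply, ← Coalgebra.coassoc_apply]
  exact (LinearMap.congr_fun (TensorProduct.map_map_comp_assoc_eq f₁ f₂ f₃) _).symm

theorem map_counit_comul {N : Type u} [AddCommGroup N] [Module k N] (f : X →ₗ[k] N) (c : X) :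
    TensorProduct.map counit f (comul (R := k) c) = 1 ⊗ₜ f c := by
  have h := congrArg (f.lTensor k) (Coalgebra.rTensor_counit_comul (R := k) c)
  rwa [← LinearMap.comp_apply, LinearMap.lTensor_comp_rTensor, LinearMap.lTensor_tmul] at h

theorem map_comul_counit {N : Type u} [AddCommGroup N] [Module k N] (f : X →ₗ[k] N) (c : X) :
    TensorProduct.map f counit (comul (R := k) c) = f c ⊗ₜ 1 := by
  have h := congrArg (f.rTensor k) (Coalgebra.lTensor_counit_comul (R := k) c)
  rwa [← LinearMap.comp_apply, LinearMap.rTensor_comp_lTensor, LinearMap.rTensor_tmul] at h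

/-- The coalgebra structure transported along a linear equivalence. -/
@[reducible] def coalgebraOfEquiv {M : Type u} [AddCommGroup M] [Module k M] (e : X ≃ₗ[k] M) :
    Coalgebra k M where
  comul := TensorProduct.map e.toLinearMap e.toLinearMap ∘ₗ comul ∘ₗ e.symm.toLinearMap
  counit := counit ∘ₗ e.symm.toLinearMap
  coassoc := by
    -- Precomposition with `e` cancels `e.symm` and leaves an identity between coproducts on `X`.
    rw [← LinearMap.cancel_right e.surjective]
    ext c
    simp [LinearMap.rTensor, LinearMap.lTensor, TensorProduct.map_map, LinearMap.comp_assoc,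
      assoc_map_map_comul]
  rTensor_counit_comp_comul := by
    rw [← LinearMap.cancel_right e.surjective]
    ext c
    simp [LinearMap.rTensor, TensorProduct.map_map, LinearMap.comp_assoc, map_counit_comul]
  lTensor_counit_comp_comul := by
    rw [← LinearMap.cancel_right e.surjective]
    ext c
    simp [LinearMap.lTensor, TensorProduct.map_map, LinearMap.comp_assoc, map_comul_counit]

end Transport

/-! ### A coalgebra with a ternary product as a coherd over itself -/

namespace Coherd

variable {k X C D Xbar : Type u} [CommRing k]
  [AddCommGroup C] [Module k C] [Coalgebra k C] [AddCommGroup D] [Module k D] [Coalgebra k D]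
  [AddCommGroup X] [Module k X] [Coalgebra k X] [AddCommGroup Xbar] [Module k Xbar]

/-- A coalgebra `X` with a ternary product `χ` is a coherd over itself, with itself as companion
and all coactions equal to the coproduct. Here the two base coalgebras and the companion are only
required to be isomorphic to `X`. -/
def ofCoalgebra (eC : X ≃ₗ[k] C) (eD : X ≃ₗ[k] D) (eX : X ≃ₗ[k] Xbar)
    (comulC : ∀ c, comul (R := k) (eC c) =
      TensorProduct.map eC.toLinearMap eC.toLinearMap (comul (R := k) c))
    (counitC : ∀ c, counit (R := k) (eC c) = counit (R := k) c)
    (comulD : ∀ c, comul (R := k) (eD c) =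
      TensorProduct.map eD.toLinearMap eD.toLinearMap (comul (R := k) c))
    (counitD : ∀ c, counit (R := k) (eD c) = counit (R := k) c)
    (χ : X ⊗[k] (X ⊗[k] X) →ₗ[k] X)
    (hl : ∀ x c : X, χ (x ⊗ₜ comul c) = counit (R := k) c • x)
    (hr : ∀ c x : X, χ (TensorProduct.assoc k X X X (comul (R := k) c ⊗ₜ x)) =
      counit (R := k) c • x)
    (h : ∀ x y x' y' x'' : X, χ (χ (x ⊗ₜ (y ⊗ₜ x')) ⊗ₜ (y' ⊗ₜ x'')) =
      χ (x ⊗ₜ (y ⊗ₜ χ (x' ⊗ₜ (y' ⊗ₜ x''))))) : Coherd k C D X Xbar :=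
  have comulC' : comul ∘ₗ eC.toLinearMap =
    TensorProduct.map eC.toLinearMap eC.toLinearMap ∘ₗ comul (R := k) := LinearMap.ext comulC
  have comulD' : comul ∘ₗ eD.toLinearMap =
    TensorProduct.map eD.toLinearMap eD.toLinearMap ∘ₗ comul (R := k) := LinearMap.ext comulD
  have counitC' : counit ∘ₗ eC.toLinearMap = counit (R := k) := LinearMap.ext counitC
  have counitD' : counit ∘ₗ eD.toLinearMap = counit (R := k) := LinearMap.ext counitD
  { ρDX := eD.toLinearMap.rTensor X ∘ₗ comul
    ρXC := eC.toLinearMap.lTensor X ∘ₗ comul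
    ρCXbar := TensorProduct.map eC.toLinearMap eX.toLinearMap ∘ₗ comul ∘ₗ eX.symm.toLinearMap
    ρXbarD := TensorProduct.map eX.toLinearMap eD.toLinearMap ∘ₗ comul ∘ₗ eX.symm.toLinearMap
    cov := eX.toLinearMap.rTensor X ∘ₗ comul ∘ₗ eC.symm.toLinearMap
    covBar := eX.toLinearMap.lTensor X ∘ₗ comul ∘ₗ eD.symm.toLinearMap
    χ := χ ∘ₗ (eX.symm.toLinearMap.rTensor X).lTensor X
    bicomodule_X := by
      refine ⟨⟨?_, ?_⟩, ⟨?_, ?_⟩, ?_⟩ <;>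
      ext c <;>
      simp [LinearMap.rTensor, LinearMap.lTensor, TensorProduct.map_map, assoc_map_map_comul,
        map_counit_comul, map_comul_counit, comulC', comulD', counitC',
        counitD']
    bicomodule_Xbar := by
      refine ⟨⟨?_, ?_⟩, ⟨?_, ?_⟩, ?_⟩ <;>
      rw [← LinearMap.cancel_right eX.surjective] <;>
      ext c <;>
      simp [LinearMap.rTensor, LinearMap.lTensor, TensorProduct.map_map, LinearMap.comp_assoc,
        assoc_map_map_comul, map_counit_comul, map_comul_counit, comulC', comulD', counitC',
        counitD']
    cov_left := by
      rw [← LinearMap.cancel_right eC.surjective]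
      ext c
      simp [LinearMap.rTensor, LinearMap.lTensor, TensorProduct.map_map, LinearMap.comp_assoc,
        assoc_map_map_comul, comulC]
    cov_right := by
      rw [← LinearMap.cancel_right eC.surjective]
      ext c
      simp [LinearMap.rTensor, LinearMap.lTensor, TensorProduct.map_map, LinearMap.comp_assoc,
        assoc_map_map_comul, comulC]
    covBar_left := by
      rw [← LinearMap.cancel_right eD.surjective]
      ext c
      simp [LinearMap.rTensor, LinearMap.lTensor, TensorProduct.map_map, LinearMap.comp_assoc,
        assoc_map_map_comul, comulD]
    covBar_right := by
      rw [← LinearMap.cancel_right eD.surjective]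
      ext c
      simp [LinearMap.rTensor, LinearMap.lTensor, TensorProduct.map_map, LinearMap.comp_assoc,
        assoc_map_map_comul, comulD]
    companion_X := by
      ext c
      simp [LinearMap.rTensor, LinearMap.lTensor, TensorProduct.map_map, LinearMap.comp_assoc,
        assoc_map_map_comul]
    companion_Xbar := by
      rw [← LinearMap.cancel_right eX.surjective]
      ext c
      simp [LinearMap.rTensor, LinearMap.lTensor, TensorProduct.map_map, LinearMap.comp_assoc,
        assoc_map_map_comul]
    χ_cov := by
      refine TensorProduct.ext' fun x c => ?_
      obtain ⟨c, rfl⟩ := eC.surjective c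
      simp [LinearMap.rTensor, TensorProduct.map_map, hl, counitC]
    χ_covBar := by
      refine TensorProduct.ext' fun d x => ?_
      obtain ⟨c, rfl⟩ := eD.surjective d
      -- Naturality of the associator brings `eX.symm`, which sits after it in `χ`, next to the `eX`
      -- of `covBar`, where the two cancel.
      have h1 := TensorProduct.map_map_comp_assoc_eq (R := k) (.id : X →ₗ[k] X)
        (eX.symm : Xbar →ₗ[k] X) (.id : X →ₗ[k] X)
      have h2 := LinearMap.congr_fun h1 (TensorProduct.map (.id : X →ₗ[k] X) eX.toLinearMap
        (comul (R := k) c) ⊗ₜ x)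
      simp only [LinearMap.comp_apply, LinearEquiv.coe_coe, TensorProduct.map_tmul,
        TensorProduct.map_map] at h2
      simp [LinearMap.lTensor, LinearMap.rTensor, h2, hr, counitD]
    χ_assoc := fun x y x' y' x'' => by simp [h] }

end Coherd

/-! ### Contraction of a tensor leg by a linear form -/

section Apply

variable {k X : Type u} [CommRing k] [AddCommGroup X] [Module k X] (φ : X →ₗ[k] k)
  (M : Type u) [AddCommGroup M] [Module k M]

/-- The map `φ ⊗ M : X ⊗ M → M`. -/
def applyLeft : X ⊗[k] M →ₗ[k] M :=
  (TensorProduct.lid k M).toLinearMap ∘ₗ φ.rTensor M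

/-- The map `M ⊗ φ : M ⊗ X → M`. -/
def applyRight : M ⊗[k] X →ₗ[k] M :=
  (TensorProduct.rid k M).toLinearMap ∘ₗ φ.lTensor M

variable {M}

@[simp] theorem applyLeft_tmul (x : X) (m : M) : applyLeft φ M (x ⊗ₜ m) = φ x • m := rfl

@[simp] theorem applyRight_tmul (m : M) (x : X) : applyRight φ M (m ⊗ₜ x) = φ x • m := rfl

theorem applyLeft_lTensor {N : Type u} [AddCommGroup N] [Module k N] (f : M →ₗ[k] N)
    (t : X ⊗[k] M) : applyLeft φ N (f.lTensor X t) = f (applyLeft φ M t) := by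
  induction t with
  | zero => simp
  | add u v hu hv => simp only [map_add, hu, hv]
  | tmul x m => simp

end Apply

/-! ### Coproducts with legs in the pen, and their contractions -/

section Twist

variable {k T That : Type u} [CommRing k] [AddCommGroup T] [Module k T] [Coalgebra k T]
  [AddCommGroup That] [Module k That] (e : T ≃ₗ[k] That)

/-- The coproduct `T → That ⊗ T`. -/
def leftComul : T →ₗ[k] That ⊗[k] T := TensorProduct.map e.toLinearMap .id ∘ₗ comul

/-- The coproduct `T → T ⊗ That`. -/
def rightComul : T →ₗ[k] T ⊗[k] That := TensorProduct.map .id e.toLinearMap ∘ₗ comul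

/-- The iterated coproduct `T → That ⊗ T ⊗ That`. -/
def barComul : T →ₗ[k] That ⊗[k] (T ⊗[k] That) :=
  TensorProduct.map e.toLinearMap (rightComul e) ∘ₗ comul

/-- The counit of `T`, transported to `That`. -/
def hatCounit : That →ₗ[k] k := counit ∘ₗ e.symm.toLinearMap

@[simp] theorem applyLeft_leftComul (x : T) :
    applyLeft (hatCounit e) T (leftComul e x) = x := by
  have h : hatCounit e ∘ₗ e.toLinearMap = counit := by simp [hatCounit, LinearMap.comp_assoc]
  simp [applyLeft, leftComul, LinearMap.rTensor, TensorProduct.map_map, h, map_counit_comul]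

@[simp] theorem applyRight_leftComul (x : T) :
    applyRight counit That (leftComul e x) = e x := by
  simp [applyRight, leftComul, LinearMap.lTensor, TensorProduct.map_map, map_comul_counit]

@[simp] theorem applyRight_rightComul (x : T) :
    applyRight (hatCounit e) T (rightComul e x) = x := by
  have h : hatCounit e ∘ₗ e.toLinearMap = counit := by simp [hatCounit, LinearMap.comp_assoc]
  simp [applyRight, rightComul, LinearMap.lTensor, TensorProduct.map_map, h, map_comul_counit]

@[simp] theorem applyLeft_rightComul (x : T) :
    applyLeft counit That (rightComul e x) = e x := by
  simp [applyLeft, rightComul, LinearMap.rTensor, TensorProduct.map_map, map_counit_comul]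

theorem lTensor_rightComul_leftComul (x : T) :
    (rightComul e).lTensor That (leftComul e x) = barComul e x := by
  simp [leftComul, barComul, LinearMap.lTensor, TensorProduct.map_map]

theorem assoc_rTensor_leftComul_rightComul (x : T) :
    TensorProduct.assoc k That T That ((leftComul e).rTensor That (rightComul e x)) =
      barComul e x := by
  have h := assoc_map_map_comul e.toLinearMap .id e.toLinearMap x
  simpa [leftComul, rightComul, barComul, LinearMap.rTensor, TensorProduct.map_map] using h

theorem assoc_rTensor_rightComul_comul (x : T) :
    TensorProduct.assoc k T That T ((rightComul e).rTensor T (comul (R := k) x)) =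
      (leftComul e).lTensor T (comul x) :=
  assoc_map_map_comul .id e.toLinearMap .id x

/-- Counitality on the outer left leg, for an arbitrary `w` and not only for a coproduct. It
recovers a tensor of `T ⊗ That` from its image in the left half `E ⊗ That` of the companion. -/
theorem applyLeft_hatCounit_assoc (w : T ⊗[k] That) :
    applyLeft (hatCounit e) _
      (TensorProduct.assoc k That T That ((leftComul e).rTensor That w)) = w := by
  induction w with
  | zero => simp
  | add u v hu hv => simp only [map_add, hu, hv]
  | tmul x y =>
    -- Once `x` is written as a contraction of its own coproduct, both sides are linear in that
    -- coproduct, which can be replaced by a pure tensor.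
    conv_rhs => rw [← applyLeft_leftComul e x]
    rw [LinearMap.rTensor_tmul]
    generalize leftComul e x = v
    induction v with
    | zero => simp
    | add u v hu hv => simp only [map_add, TensorProduct.add_tmul, hu, hv]
    | tmul q r => simp [TensorProduct.smul_tmul']

/-- The counit on the middle leg of `That ⊗ T ⊗ That` undoes a coproduct on either side of it. This
lemma and `lTensor_applyLeft_rightComul` therefore compare a tensor coming from `E ⊗ That` with one
coming from `That ⊗ F`. -/
theorem lTensor_applyLeft_assoc (w : T ⊗[k] That) :
    (applyLeft counit That).lTensor That
      (TensorProduct.assoc k That T That ((leftComul e).rTensor That w)) =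
    TensorProduct.map e.toLinearMap .id w := by
  induction w with
  | zero => simp
  | add u v hu hv => simp only [map_add, hu, hv]
  | tmul x y =>
    rw [TensorProduct.map_tmul, LinearEquiv.coe_coe, ← applyRight_leftComul e x,
      LinearMap.rTensor_tmul]
    generalize leftComul e x = v
    induction v with
    | zero => simp
    | add u v hu hv => simp only [map_add, TensorProduct.add_tmul, hu, hv]
    | tmul q r => simp [TensorProduct.smul_tmul]

theorem lTensor_applyLeft_rightComul (w : That ⊗[k] T) :
    (applyLeft counit That).lTensor That ((rightComul e).lTensor That w) =
      TensorProduct.map .id e.toLinearMap w := by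
  induction w with
  | zero => simp
  | add u v hu hv => simp only [map_add, hu, hv]
  | tmul x y => simp

end Twist

/-! ### Herds whose shepherd is an iterated coproduct: `E`, `F` and the companion as copies of `T`
-/

namespace Herd

variable {k A B T That : Type u} [CommRing k] [Ring A] [Algebra k A] [Ring B] [Algebra k B]
  [AddCommGroup T] [Module k T] [Module B T] [Module Aᵐᵒᵖ T] [SMulCommClass B Aᵐᵒᵖ T]
  [IsScalarTower k B T] [IsScalarTower k Aᵐᵒᵖ T]
  [AddCommGroup That] [Module k That] [Module A That] [Module Bᵐᵒᵖ That]
  [SMulCommClass A Bᵐᵒᵖ That] [IsScalarTower k A That] [IsScalarTower k Bᵐᵒᵖ That]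
  [Coalgebra k T]

/-- `T` is a coalgebra, and `e` identifies the pen of the herd `G` with `T`, in such a way that the
shepherd is the iterated coproduct, and that both evaluations restrict to the counit along the
coproduct. -/
structure IsCoalgebraic (G : Herd k A B T That) (e : T ≃ₗ[k] That) : Prop where
  γ_eq : G.γ = (leftComul e).lTensor T ∘ₗ comul
  ev_comul : ∀ x, G.ev (leftComul e x) = algebraMap k A (counit x)
  evHat_comul : ∀ x, G.evHat (rightComul e x) = algebraMap k B (counit x)
  algebraMap_left_injective : Function.Injective (algebraMap k A)
  algebraMap_right_injective : Function.Injective (algebraMap k B)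

namespace IsCoalgebraic

variable {G : Herd k A B T That} {e : T ≃ₗ[k] That}

theorem ev_comp_comul (hG : G.IsCoalgebraic e) :
    G.ev ∘ₗ leftComul e = Algebra.linearMap k A ∘ₗ counit :=
  LinearMap.ext hG.ev_comul

theorem evHat_comp_comul (hG : G.IsCoalgebraic e) :
    G.evHat ∘ₗ rightComul e = Algebra.linearMap k B ∘ₗ counit :=
  LinearMap.ext hG.evHat_comul

/-- By coassociativity the fourfold coproduct may be bracketed in pairs. This makes `leftComul`
comultiplicative for the coproduct prescribed on `E`. -/
theorem hatγ_leftComul (hG : G.IsCoalgebraic e) (c : T) :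
    G.hatγ (leftComul e c) = TensorProduct.map (leftComul e) (leftComul e) (comul (R := k) c) := by
  have h := assoc_map_map_comul (k := k) e.toLinearMap .id (leftComul e) c
  rw [hatγ, LinearMap.comp_apply, LinearEquiv.coe_coe, LinearEquiv.symm_apply_eq, hG.γ_eq]
  rw [← leftComul] at h
  rw [h]
  simp [leftComul, LinearMap.lTensor, TensorProduct.map_map]

/-- The fourfold coproduct bracketed as one leg followed by three. In this form it factors through
the companion, as `covBar` requires. -/
theorem γhatNested_rightComul (hG : G.IsCoalgebraic e) (c : T) :
    G.γhatNested (rightComul e c) = (barComul e).lTensor T (comul (R := k) c) := by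
  have h := assoc_map_map_comul (k := k) (.id : T →ₗ[k] T) (leftComul e) e.toLinearMap c
  have h' : (TensorProduct.assoc k That T That).toLinearMap ∘ₗ
      TensorProduct.map (leftComul e) e.toLinearMap ∘ₗ comul (R := k) = barComul e :=
    LinearMap.ext (assoc_map_map_comul e.toLinearMap .id e.toLinearMap)
  simp only [γhatNested, hG.γ_eq, rightComul, LinearMap.rTensor, LinearMap.lTensor,
    LinearMap.comp_apply, TensorProduct.map_map, LinearEquiv.coe_coe, LinearMap.comp_id,
    LinearMap.id_comp, h, h']

theorem γhat_rightComul (hG : G.IsCoalgebraic e) (c : T) :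
    G.γhat (rightComul e c) =
      TensorProduct.map (rightComul e) (rightComul e) (comul (R := k) c) := by
  rw [γhat, LinearMap.comp_apply, LinearEquiv.coe_coe, LinearEquiv.symm_apply_eq,
    hG.γhatNested_rightComul]
  exact (assoc_map_map_comul (k := k) (.id : T →ₗ[k] T) e.toLinearMap (rightComul e) c).symm

/-- The fourfold coproduct pairs up as two coproducts; `ev` turns the first pair into a counit,
which is absorbed. -/
theorem leftComul_mem_E (hG : G.IsCoalgebraic e) (c : T) : leftComul e c ∈ G.E := by
  rw [E, LinearMap.mem_eqLocus, LinearMap.comp_apply, hG.hatγ_leftComul, LinearMap.rTensor,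
    TensorProduct.map_map, hG.ev_comp_comul, LinearMap.id_comp]
  have := congrArg (TensorProduct.map (Algebra.linearMap k A) .id)
    (map_counit_comul (k := k) (leftComul e) c)
  simpa [TensorProduct.map_map] using this

theorem rightComul_mem_F (hG : G.IsCoalgebraic e) (c : T) : rightComul e c ∈ G.F := by
  rw [F, LinearMap.mem_eqLocus, LinearMap.comp_apply, hG.γhat_rightComul, LinearMap.lTensor,
    TensorProduct.map_map, hG.evHat_comp_comul, LinearMap.id_comp]
  have := congrArg (TensorProduct.map .id (Algebra.linearMap k B))
    (map_comul_counit (k := k) (rightComul e) c)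
  simpa [TensorProduct.map_map] using this

/-- In Sweedler notation, `ev(y ⊗ x₁) x₂ ⊗ x₃ = y ⊗ x`. -/
theorem ev_smul_comul (hG : G.IsCoalgebraic e) (t : That ⊗[k] T) :
    (actL k A That).rTensor T ((TensorProduct.assoc k A That T).symm ((leftComul e).lTensor A
      (G.ev.rTensor T ((TensorProduct.assoc k That T T).symm (comul.lTensor That t))))) = t := by
  induction t with
  | zero => simp
  | add u v hu hv => simp only [map_add, hu, hv]
  | tmul y x =>
    -- The axiom `smul_evHat` trades `ev(y ⊗ p) q` for `y evHat(p ⊗ q)`, which is `R (p ⊗ q)`. Now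
    -- `evHat` meets two adjacent legs of a coproduct and becomes a counit.
    let R : T ⊗[k] That →ₗ[k] That := actR k B That ∘ₗ TensorProduct.mk k That B y ∘ₗ G.evHat
    have h1 : ∀ u : T ⊗[k] T, (actL k A That).rTensor T ((TensorProduct.assoc k A That T).symm
        ((leftComul e).lTensor A
          (G.ev.rTensor T ((TensorProduct.assoc k That T T).symm (y ⊗ₜ u))))) =
        R.rTensor T ((TensorProduct.assoc k T That T).symm ((leftComul e).lTensor T u)) := by
      intro u
      induction u with
      | zero => simp
      | add u v hu hv => simp only [map_add, TensorProduct.tmul_add, hu, hv]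
      | tmul p q =>
        simp only [TensorProduct.assoc_symm_tmul, LinearMap.rTensor_tmul, LinearMap.lTensor_tmul]
        generalize leftComul e q = v
        induction v with
        | zero => simp
        | add u v hu hv => simp only [map_add, TensorProduct.tmul_add, hu, hv]
        | tmul q r => simp [R, G.smul_evHat]
    have h2 : R ∘ₗ rightComul e = LinearMap.toSpanSingleton k That y ∘ₗ counit := by
      ext x
      simp [R, hG.evHat_comul, Algebra.algebraMap_eq_smul_one]
    have h3 := congrArg (TensorProduct.map (LinearMap.toSpanSingleton k That y) .id)
      (map_counit_comul (k := k) (.id : T →ₗ[k] _) x)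
    rw [LinearMap.lTensor_tmul, h1, ← assoc_rTensor_rightComul_comul, LinearEquiv.symm_apply_apply,
      LinearMap.rTensor, LinearMap.rTensor, TensorProduct.map_map, h2]
    simpa [TensorProduct.map_map] using h3

/-- In Sweedler notation, `x₁ ⊗ x₂ evHat(x₃ ⊗ y) = x ⊗ y`. -/
theorem comul_smul_evHat (hG : G.IsCoalgebraic e) (t : T ⊗[k] That) :
    (actR k B That).lTensor T (TensorProduct.assoc k T That B ((rightComul e).rTensor B
      (G.evHat.lTensor T (TensorProduct.assoc k T T That (comul.rTensor That t))))) = t := by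
  induction t with
  | zero => simp
  | add u v hu hv => simp only [map_add, hu, hv]
  | tmul x y =>
    -- The same exchange in the other direction: `q evHat(p ⊗ y) = ev(q ⊗ p) y`, so that `ev` meets
    -- two adjacent legs of a coproduct.
    let R : That ⊗[k] T →ₗ[k] That := actL k A That ∘ₗ (TensorProduct.mk k A That).flip y ∘ₗ G.ev
    have h1 : ∀ u : T ⊗[k] T, (actR k B That).lTensor T (TensorProduct.assoc k T That B
        ((rightComul e).rTensor B
          (G.evHat.lTensor T (TensorProduct.assoc k T T That (u ⊗ₜ y))))) =
        R.lTensor T (TensorProduct.assoc k T That T ((rightComul e).rTensor T u)) := by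
      intro u
      induction u with
      | zero => simp
      | add u v hu hv => simp only [map_add, TensorProduct.add_tmul, hu, hv]
      | tmul p q =>
        simp only [TensorProduct.assoc_tmul, LinearMap.rTensor_tmul, LinearMap.lTensor_tmul]
        generalize rightComul e p = v
        induction v with
        | zero => simp
        | add u v hu hv => simp only [map_add, TensorProduct.add_tmul, hu, hv]
        | tmul p r => simp [R, G.smul_evHat]
    have h2 : R ∘ₗ leftComul e = LinearMap.toSpanSingleton k That y ∘ₗ counit := by
      ext x
      simp [R, hG.ev_comul, Algebra.algebraMap_eq_smul_one]
    have h3 := congrArg (TensorProduct.map .id (LinearMap.toSpanSingleton k That y))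
      (map_comul_counit (k := k) (.id : T →ₗ[k] _) x)
    rw [LinearMap.rTensor_tmul, h1, assoc_rTensor_rightComul_comul, LinearMap.lTensor,
      LinearMap.lTensor, TensorProduct.map_map, h2]
    simpa [TensorProduct.map_map] using h3

/-- A counit on the second pen leg of `ev(y ⊗ x₁) ⊗ x₂ ⊗ x₃` leaves `ev(y ⊗ x₁) ⊗ x₂`, from which
`ev_smul_comul` rebuilds `t`. The equaliser condition replaces the same expression by `1 ⊗ ε(y) x`,
from which the procedure rebuilds a coproduct. -/
theorem leftComul_applyLeft_of_mem_E (hG : G.IsCoalgebraic e) {t : That ⊗[k] T}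
    (ht : t ∈ G.E) : leftComul e (applyLeft (hatCounit e) T t) = t := by
  have h1 : ∀ t : That ⊗[k] T,
      (applyLeft (hatCounit e) T).lTensor A (G.ev.rTensor (That ⊗[k] T) (G.hatγ t)) =
      G.ev.rTensor T ((TensorProduct.assoc k That T T).symm (comul.lTensor That t)) := by
    intro t
    induction t with
    | zero => simp
    | add u v hu hv => simp only [map_add, hu, hv]
    | tmul y x =>
      simp only [hatγ, hG.γ_eq, LinearMap.comp_apply, LinearMap.lTensor_tmul, LinearEquiv.coe_coe]
      generalize comul (R := k) x = v
      induction v with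
      | zero => simp
      | add u v hu hv => simp only [map_add, TensorProduct.tmul_add, hu, hv]
      | tmul q r => simp
  have h2 := hG.ev_smul_comul t
  rw [E, LinearMap.mem_eqLocus, LinearMap.comp_apply] at ht
  rw [← h1, ht] at h2
  simp only [TensorProduct.mk_apply, LinearMap.lTensor_tmul] at h2
  refine Eq.trans ?_ h2
  generalize leftComul e (applyLeft (hatCounit e) T t) = v
  induction v with
  | zero => simp
  | add u v hu hv => simp only [map_add, TensorProduct.tmul_add, ← hu, ← hv]
  | tmul q r => simp

/-- Mirror image of the argument for `E`: a counit on the first pen leg leaves `x₁ ⊗ evHat(x₂ ⊗ y)`,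
and `comul_smul_evHat` plays the role of `ev_smul_comul`. -/
theorem rightComul_applyRight_of_mem_F (hG : G.IsCoalgebraic e) {t : T ⊗[k] That}
    (ht : t ∈ G.F) : rightComul e (applyRight (hatCounit e) T t) = t := by
  have h1 : ∀ t : T ⊗[k] That,
      (applyRight (hatCounit e) T).rTensor B (G.evHat.lTensor (T ⊗[k] That) (G.γhat t)) =
      G.evHat.lTensor T (TensorProduct.assoc k T T That (comul.rTensor That t)) := by
    intro t
    induction t with
    | zero => simp
    | add u v hu hv => simp only [map_add, hu, hv]
    | tmul x y =>
      simp only [γhat, γhatNested, hG.γ_eq, LinearMap.comp_apply, LinearMap.rTensor_tmul,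
        LinearEquiv.coe_coe]
      generalize comul (R := k) x = v
      induction v with
      | zero => simp
      | add u v hu hv => simp only [map_add, TensorProduct.add_tmul, hu, hv]
      | tmul p q =>
        conv_rhs => rw [← applyLeft_leftComul e q]
        rw [LinearMap.lTensor_tmul]
        generalize leftComul e q = v
        induction v with
        | zero => simp
        | add u v hu hv =>
          simp only [map_add, TensorProduct.add_tmul, TensorProduct.tmul_add, hu, hv]
        | tmul q r => simp [TensorProduct.smul_tmul]
  have h2 := hG.comul_smul_evHat t
  rw [F, LinearMap.mem_eqLocus, LinearMap.comp_apply] at ht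
  rw [← h1, ht] at h2
  simp only [TensorProduct.mk_apply, LinearMap.flip_apply, LinearMap.rTensor_tmul] at h2
  refine Eq.trans ?_ h2
  generalize rightComul e (applyRight (hatCounit e) T t) = v
  induction v with
  | zero => simp
  | add u v hu hv => simp only [map_add, TensorProduct.add_tmul, ← hu, ← hv]
  | tmul q r => simp

/-- The coproduct identifies `T` with `E`. -/
def equivE (hG : G.IsCoalgebraic e) : T ≃ₗ[k] G.E where
  __ := (leftComul e).codRestrict G.E hG.leftComul_mem_E
  invFun t := applyLeft (hatCounit e) T t
  left_inv c := applyLeft_leftComul e c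
  right_inv t := Subtype.ext (hG.leftComul_applyLeft_of_mem_E t.2)

/-- The coproduct identifies `T` with `F`. -/
def equivF (hG : G.IsCoalgebraic e) : T ≃ₗ[k] G.F where
  __ := (rightComul e).codRestrict G.F hG.rightComul_mem_F
  invFun t := applyRight (hatCounit e) T t
  left_inv c := applyRight_rightComul e c
  right_inv t := Subtype.ext (hG.rightComul_applyRight_of_mem_F t.2)

@[simp] theorem coe_equivE (hG : G.IsCoalgebraic e) (c : T) :
    (hG.equivE c : That ⊗[k] T) = leftComul e c := rfl

@[simp] theorem coe_equivF (hG : G.IsCoalgebraic e) (c : T) :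
    (hG.equivF c : T ⊗[k] That) = rightComul e c := rfl

theorem subtype_comp_equivE (hG : G.IsCoalgebraic e) :
    G.E.subtype ∘ₗ hG.equivE.toLinearMap = leftComul e := rfl

theorem subtype_comp_equivF (hG : G.IsCoalgebraic e) :
    G.F.subtype ∘ₗ hG.equivF.toLinearMap = rightComul e := rfl

/-- The two bracketings of the threefold coproduct exhibit it in `E ⊗ That` and in `That ⊗ F`. -/
theorem barComul_mem_bar (hG : G.IsCoalgebraic e) (c : T) : barComul e c ∈ G.bar := by
  refine ⟨⟨hG.equivE.toLinearMap.rTensor That (rightComul e c), ?_⟩,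
    ⟨hG.equivF.toLinearMap.lTensor That (leftComul e c), ?_⟩⟩
  · rw [LinearMap.comp_apply, ← LinearMap.comp_apply (f := G.E.subtype.rTensor That),
      ← LinearMap.rTensor_comp, hG.subtype_comp_equivE]
    exact assoc_rTensor_leftComul_rightComul e c
  · rw [← LinearMap.comp_apply, ← LinearMap.lTensor_comp, hG.subtype_comp_equivF,
      lTensor_rightComul_leftComul]

/-- Through `E ≃ T` and `F ≃ T`, an element of the intersection is both `(Δ ⊗ id) u` and `(id ⊗ Δ)
v`. A counit on the middle leg gives `u = v` up to `e`. A counit on the left leg gives `u = Δ w`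
with `w = (ε ⊗ id) v`. Hence `v = Δ w` too, and the element is the threefold coproduct of `w`. -/
theorem barComul_contract_of_mem_bar (hG : G.IsCoalgebraic e) {t : That ⊗[k] (T ⊗[k] That)}
    (ht : t ∈ G.bar) :
    barComul e (applyRight (hatCounit e) T (applyLeft (hatCounit e) _ t)) = t := by
  obtain ⟨⟨u, hu⟩, ⟨v, hv⟩⟩ := ht
  obtain ⟨u, rfl⟩ := (hG.equivE.rTensor That).surjective u
  obtain ⟨v, rfl⟩ := (hG.equivF.lTensor That).surjective v
  rw [← LinearEquiv.coe_coe, LinearEquiv.coe_lTensor, ← LinearMap.comp_apply,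
    ← LinearMap.lTensor_comp, hG.subtype_comp_equivF] at hv
  rw [← LinearEquiv.coe_coe, LinearEquiv.coe_rTensor, LinearMap.comp_apply,
    ← LinearMap.comp_apply (f := G.E.subtype.rTensor That),
    ← LinearMap.rTensor_comp, hG.subtype_comp_equivE, LinearEquiv.coe_coe] at hu
  have h1 : TensorProduct.map e.toLinearMap .id u = TensorProduct.map .id e.toLinearMap v := by
    rw [← lTensor_applyLeft_assoc, hu, ← hv, lTensor_applyLeft_rightComul]
  have h2 : u = rightComul e (applyLeft (hatCounit e) T v) := by
    rw [← applyLeft_lTensor, hv, ← hu, applyLeft_hatCounit_assoc]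
  have h3 : v = leftComul e (applyLeft (hatCounit e) T v) := by
    have h4 := congrArg (TensorProduct.map .id e.symm.toLinearMap) h1
    conv_lhs at h4 => rw [h2]
    simp only [rightComul, LinearMap.comp_apply, TensorProduct.map_map, LinearMap.comp_id,
      LinearMap.id_comp, LinearEquiv.symm_comp, TensorProduct.map_id, LinearMap.id_apply] at h4
    exact h4.symm
  have h5 : applyLeft (hatCounit e) _ t = u := by rw [← hu, applyLeft_hatCounit_assoc]
  rw [h5, h2, applyRight_rightComul, ← lTensor_rightComul_leftComul, ← h3, hv]

/-- The iterated coproduct identifies `T` with the companion `(E ⊗ That) ∩ (That ⊗ F)`. -/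
def equivBar (hG : G.IsCoalgebraic e) : T ≃ₗ[k] G.bar where
  __ := (barComul e).codRestrict G.bar hG.barComul_mem_bar
  invFun t := applyRight (hatCounit e) T (applyLeft (hatCounit e) _ t)
  left_inv c := by
    change applyRight (hatCounit e) T (applyLeft (hatCounit e) _ (barComul e c)) = c
    rw [← lTensor_rightComul_leftComul, applyLeft_lTensor, applyLeft_leftComul,
      applyRight_rightComul]
  right_inv t := Subtype.ext (hG.barComul_contract_of_mem_bar t.2)

@[simp] theorem coe_equivBar (hG : G.IsCoalgebraic e) (c : T) :
    (hG.equivBar c : That ⊗[k] (T ⊗[k] That)) = barComul e c := rfl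

theorem subtype_comp_equivBar (hG : G.IsCoalgebraic e) :
    G.bar.subtype ∘ₗ hG.equivBar.toLinearMap = barComul e := rfl

end IsCoalgebraic
end Herd

/-! ### Split inclusions, equality of coalgebra structures, and fourfold coassociativity -/

theorem map_injective_of_comp_eq_id {k M N M' N' : Type u} [CommRing k] [AddCommGroup M]
    [Module k M] [AddCommGroup N] [Module k N] [AddCommGroup M'] [Module k M'] [AddCommGroup N']
    [Module k N'] {f : M →ₗ[k] M'} {g : N →ₗ[k] N'} {f' : M' →ₗ[k] M} {g' : N' →ₗ[k] N}
    (hf : f' ∘ₗ f = .id) (hg : g' ∘ₗ g = .id) : Function.Injective (TensorProduct.map f g) := by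
  refine Function.LeftInverse.injective (g := TensorProduct.map f' g') fun t => ?_
  rw [TensorProduct.map_map, hf, hg, TensorProduct.map_id, LinearMap.id_apply]

theorem coalgebra_ext {k M : Type u} [CommRing k] [AddCommGroup M] [Module k M]
    {c c' : Coalgebra k M} (h : c.comul = c'.comul) (h' : c.counit = c'.counit) : c = c' := by
  obtain @⟨⟨_, _⟩, _, _, _⟩ := c
  obtain @⟨⟨_, _⟩, _, _, _⟩ := c'
  obtain rfl := h
  obtain rfl := h'
  rfl

theorem lTensor_assoc_assoc_map_comul {k X N₁ N₂ N₃ N₄ : Type u} [CommRing k]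
    [AddCommGroup X] [Module k X] [Coalgebra k X] [AddCommGroup N₁] [Module k N₁]
    [AddCommGroup N₂] [Module k N₂] [AddCommGroup N₃] [Module k N₃] [AddCommGroup N₄] [Module k N₄]
    (f₁ : X →ₗ[k] N₁) (f₂ : X →ₗ[k] N₂) (f₃ : X →ₗ[k] N₃) (f₄ : X →ₗ[k] N₄) (c : X) :
    (TensorProduct.assoc k N₂ N₃ N₄).toLinearMap.lTensor N₁
      (TensorProduct.assoc k N₁ (N₂ ⊗[k] N₃) N₄
        (TensorProduct.map (TensorProduct.map f₁ (TensorProduct.map f₂ f₃ ∘ₗ comul) ∘ₗ comul) f₄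
          (comul (R := k) c))) =
    TensorProduct.map f₁ (TensorProduct.map f₂ (TensorProduct.map f₃ f₄ ∘ₗ comul) ∘ₗ comul)
      (comul (R := k) c) := by
  rw [assoc_map_map_comul, LinearMap.lTensor, TensorProduct.map_map, LinearMap.id_comp]
  congr 2
  exact LinearMap.ext (assoc_map_map_comul f₂ f₃ f₄)

namespace Herd

variable {k A B T That : Type u} [CommRing k] [Ring A] [Algebra k A] [Ring B] [Algebra k B]
  [AddCommGroup T] [Module k T] [Module B T] [Module Aᵐᵒᵖ T] [SMulCommClass B Aᵐᵒᵖ T]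
  [IsScalarTower k B T] [IsScalarTower k Aᵐᵒᵖ T]
  [AddCommGroup That] [Module k That] [Module A That] [Module Bᵐᵒᵖ That]
  [SMulCommClass A Bᵐᵒᵖ That] [IsScalarTower k A That] [IsScalarTower k Bᵐᵒᵖ That]
  [Coalgebra k T]

namespace IsCoalgebraic

variable {G : Herd k A B T That} {e : T ≃ₗ[k] That}

/-- The inverse of `equivE` is a contraction defined on all of `That ⊗ T`, so the inclusion of `E`
splits and stays injective under tensor products. -/
theorem retract_E (hG : G.IsCoalgebraic e) :
    (hG.equivE.toLinearMap ∘ₗ applyLeft (hatCounit e) T) ∘ₗ G.E.subtype = .id :=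
  LinearMap.ext hG.equivE.apply_symm_apply

theorem retract_F (hG : G.IsCoalgebraic e) :
    (hG.equivF.toLinearMap ∘ₗ applyRight (hatCounit e) T) ∘ₗ G.F.subtype = .id :=
  LinearMap.ext hG.equivF.apply_symm_apply

theorem retract_bar (hG : G.IsCoalgebraic e) :
    (hG.equivBar.toLinearMap ∘ₗ applyRight (hatCounit e) T ∘ₗ applyLeft (hatCounit e) _) ∘ₗ
      G.bar.subtype = .id :=
  LinearMap.ext hG.equivBar.apply_symm_apply

/-! ### The coalgebra structures on `E` and `F` -/

section CoalgebraE

variable {cE : Coalgebra k G.E}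

/-- Both sides agree in `(That ⊗ T) ⊗ (That ⊗ T)`, where `E ⊗ E` embeds. As `cE` is arbitrary, this
serves both the uniqueness of the structure and the isomorphism with `T`. -/
theorem comul_equivE (hG : G.IsCoalgebraic e) (h : G.IsCoalgebraE cE) (c : T) :
    comul (R := k) (hG.equivE c) =
      TensorProduct.map hG.equivE.toLinearMap hG.equivE.toLinearMap (comul (R := k) c) := by
  apply map_injective_of_comp_eq_id hG.retract_E hG.retract_E
  rw [h.comul_eq, coe_equivE, hG.hatγ_leftComul, TensorProduct.map_map, subtype_comp_equivE]

theorem counit_equivE (hG : G.IsCoalgebraic e) (h : G.IsCoalgebraE cE) (c : T) :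
    counit (R := k) (hG.equivE c) = counit (R := k) c := by
  apply hG.algebraMap_left_injective
  rw [h.counit_eq, coe_equivE, hG.ev_comul]

/-- The coproduct is an isomorphism of coalgebras `T ≃ E`. -/
def coalgEquivE (hG : G.IsCoalgebraic e) (h : G.IsCoalgebraE cE) : T ≃ₗc[k] G.E where
  __ := hG.equivE
  counit_comp := LinearMap.ext (hG.counit_equivE h)
  map_comp_comul := LinearMap.ext fun c => (hG.comul_equivE h c).symm

theorem isCoalgebraE (hG : G.IsCoalgebraic e) : G.IsCoalgebraE (coalgebraOfEquiv hG.equivE) := by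
  constructor
  · intro e
    obtain ⟨c, rfl⟩ := hG.equivE.surjective e
    rw [coe_equivE, hG.hatγ_leftComul, ← hG.subtype_comp_equivE, ← TensorProduct.map_map]
    simp [comul]
  · intro e
    obtain ⟨c, rfl⟩ := hG.equivE.surjective e
    rw [coe_equivE, hG.ev_comul]
    simp [counit]

theorem existsUnique_coalgebraE (hG : G.IsCoalgebraic e) :
    ∃! cE : Coalgebra k G.E, G.IsCoalgebraE cE := by
  refine ⟨_, hG.isCoalgebraE, fun c hc => ?_⟩
  apply coalgebra_ext
  · rw [← LinearMap.cancel_right hG.equivE.surjective]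
    exact LinearMap.ext fun x =>
      (hG.comul_equivE hc x).trans (hG.comul_equivE hG.isCoalgebraE x).symm
  · rw [← LinearMap.cancel_right hG.equivE.surjective]
    exact LinearMap.ext fun x =>
      (hG.counit_equivE hc x).trans (hG.counit_equivE hG.isCoalgebraE x).symm

end CoalgebraE

section CoalgebraF

variable {cF : Coalgebra k G.F}

theorem comul_equivF (hG : G.IsCoalgebraic e) (h : G.IsCoalgebraF cF) (c : T) :
    comul (R := k) (hG.equivF c) =
      TensorProduct.map hG.equivF.toLinearMap hG.equivF.toLinearMap (comul (R := k) c) := by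
  apply map_injective_of_comp_eq_id hG.retract_F hG.retract_F
  rw [h.comul_eq, coe_equivF, hG.γhat_rightComul, TensorProduct.map_map, subtype_comp_equivF]

theorem counit_equivF (hG : G.IsCoalgebraic e) (h : G.IsCoalgebraF cF) (c : T) :
    counit (R := k) (hG.equivF c) = counit (R := k) c := by
  apply hG.algebraMap_right_injective
  rw [h.counit_eq, coe_equivF, hG.evHat_comul]

/-- The coproduct is an isomorphism of coalgebras `T ≃ F`. -/
def coalgEquivF (hG : G.IsCoalgebraic e) (h : G.IsCoalgebraF cF) : T ≃ₗc[k] G.F where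
  __ := hG.equivF
  counit_comp := LinearMap.ext (hG.counit_equivF h)
  map_comp_comul := LinearMap.ext fun c => (hG.comul_equivF h c).symm

theorem isCoalgebraF (hG : G.IsCoalgebraic e) : G.IsCoalgebraF (coalgebraOfEquiv hG.equivF) := by
  constructor
  · intro e
    obtain ⟨c, rfl⟩ := hG.equivF.surjective e
    rw [coe_equivF, hG.γhat_rightComul, ← hG.subtype_comp_equivF, ← TensorProduct.map_map]
    simp [comul]
  · intro e
    obtain ⟨c, rfl⟩ := hG.equivF.surjective e
    rw [coe_equivF, hG.evHat_comul]
    simp [counit]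

theorem existsUnique_coalgebraF (hG : G.IsCoalgebraic e) :
    ∃! cF : Coalgebra k G.F, G.IsCoalgebraF cF := by
  refine ⟨_, hG.isCoalgebraF, fun c hc => ?_⟩
  apply coalgebra_ext
  · rw [← LinearMap.cancel_right hG.equivF.surjective]
    exact LinearMap.ext fun x =>
      (hG.comul_equivF hc x).trans (hG.comul_equivF hG.isCoalgebraF x).symm
  · rw [← LinearMap.cancel_right hG.equivF.surjective]
    exact LinearMap.ext fun x =>
      (hG.counit_equivF hc x).trans (hG.counit_equivF hG.isCoalgebraF x).symm

end CoalgebraF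

/-- The ternary product `x ⊗ (y ⊗ z) ↦ x ev(y ⊗ z)` of `T`. -/
def ternary (G : Herd k A B T That) (e : T ≃ₗ[k] That) : T ⊗[k] (T ⊗[k] T) →ₗ[k] T :=
  actR k A T ∘ₗ (G.ev ∘ₗ TensorProduct.map e.toLinearMap .id).lTensor T

@[simp] theorem ternary_tmul (x : T) (t : T ⊗[k] T) :
    ternary G e (x ⊗ₜ t) = op (G.ev (TensorProduct.map e.toLinearMap .id t)) • x := by
  simp [ternary]

theorem op_ev_leftComul_smul (hG : G.IsCoalgebraic e) (x c : T) :
    op (G.ev (leftComul e c)) • x = counit (R := k) c • x := by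
  rw [hG.ev_comul, Algebra.algebraMap_eq_smul_one, op_smul, op_one, smul_assoc, one_smul]

theorem ternary_comul (hG : G.IsCoalgebraic e) (x c : T) :
    ternary G e (x ⊗ₜ comul c) = counit (R := k) c • x :=
  (ternary_tmul x _).trans (hG.op_ev_leftComul_smul x c)

/-- The exchange axiom `evHat_smul` lets the ternary product be computed from its first two entries,
so that left counitality reduces to `evHat` along the coproduct. -/
theorem ternary_assoc_tmul (t : T ⊗[k] T) (x : T) :
    ternary G e (TensorProduct.assoc k T T T (t ⊗ₜ x)) =
      G.evHat (TensorProduct.map .id e.toLinearMap t) • x := by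
  induction t with
  | zero => simp
  | add u v hu hv => simp only [map_add, TensorProduct.add_tmul, add_smul, hu, hv]
  | tmul y z => simp [G.evHat_smul]

theorem ternary_comul_assoc (hG : G.IsCoalgebraic e) (c x : T) :
    ternary G e (TensorProduct.assoc k T T T (comul (R := k) c ⊗ₜ x)) =
      counit (R := k) c • x := by
  rw [ternary_assoc_tmul, ← LinearMap.comp_apply (f := TensorProduct.map _ _), ← rightComul,
    hG.evHat_comul, Algebra.algebraMap_eq_smul_one, smul_assoc, one_smul]

/-- By `evHat_smul`, `evHat(x ⊗ c₁) c₂ ev(c₃ ⊗ z) = x ev(c₁ ⊗ c₂) ev(c₃ ⊗ z)`, and `ev(c₁ ⊗ c₂)` is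
a counit. The structure map on the companion thus becomes the ternary product on `T`. -/
theorem χFull_barComul (hG : G.IsCoalgebraic e) (x c z : T) :
    G.χFull (x ⊗ₜ (barComul e c ⊗ₜ z)) = op (G.ev (e c ⊗ₜ z)) • x := by
  have h1 : ∀ (u : That ⊗[k] T) (y : That),
      G.χFull (x ⊗ₜ (TensorProduct.assoc k That T That (u ⊗ₜ y) ⊗ₜ z)) =
        op (G.ev (y ⊗ₜ z)) • op (G.ev u) • x := by
    intro u y
    induction u with
    | zero => simp
    | add u v hu hv =>
      simp only [map_add, TensorProduct.add_tmul, TensorProduct.tmul_add, op_add, add_smul,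
        smul_add, hu, hv]
    | tmul p q => rw [TensorProduct.assoc_tmul, χFull_tmul, smul_comm, G.evHat_smul]
  have h2 : ∀ s : T ⊗[k] That,
      G.χFull (x ⊗ₜ (TensorProduct.assoc k That T That ((leftComul e).rTensor That s) ⊗ₜ z)) =
        op (G.ev (applyLeft counit That s ⊗ₜ z)) • x := by
    intro s
    induction s with
    | zero => simp
    | add u v hu hv =>
      simp only [map_add, TensorProduct.add_tmul, TensorProduct.tmul_add, op_add, add_smul, hu, hv]
    | tmul p q =>
      rw [LinearMap.rTensor_tmul, h1, hG.op_ev_leftComul_smul, applyLeft_tmul,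
        ← TensorProduct.smul_tmul', map_smul, op_smul, smul_assoc, smul_comm]
  rw [← assoc_rTensor_leftComul_rightComul, h2, applyLeft_rightComul]

theorem hatγhat_equivBar (hG : G.IsCoalgebraic e) (c : T) :
    G.hatγhat (hG.equivBar c) =
      TensorProduct.map e.toLinearMap ((barComul e).lTensor T ∘ₗ comul) (comul (R := k) c) := by
  have h : G.γhatNested ∘ₗ rightComul e = (barComul e).lTensor T ∘ₗ comul :=
    LinearMap.ext hG.γhatNested_rightComul
  rw [hatγhat, coe_equivBar, barComul, LinearMap.comp_apply, LinearMap.lTensor,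
    TensorProduct.map_map, h, LinearMap.id_comp]
  rfl

theorem cov_leftComul (hG : G.IsCoalgebraic e) (c : T) :
    (TensorProduct.assoc k T That T).toLinearMap.lTensor That
      (TensorProduct.assoc k That (T ⊗[k] That) T (G.bar.subtype.rTensor T
        (hG.equivBar.toLinearMap.rTensor T (comul (R := k) c)))) =
      G.γ.lTensor That (hG.equivE c) := by
  have h := lTensor_assoc_assoc_map_comul (k := k) e.toLinearMap .id e.toLinearMap .id c
  rw [LinearMap.rTensor, LinearMap.rTensor, TensorProduct.map_map, subtype_comp_equivBar,
    coe_equivE, hG.γ_eq, LinearMap.id_comp]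
  refine h.trans ?_
  simp [leftComul, LinearMap.lTensor, TensorProduct.map_map]

theorem covBar_rightComul (hG : G.IsCoalgebraic e) (c : T) :
    G.bar.subtype.lTensor T (hG.equivBar.toLinearMap.lTensor T (comul (R := k) c)) =
      G.γhatNested (hG.equivF c) := by
  rw [coe_equivF, hG.γhatNested_rightComul, ← subtype_comp_equivBar hG, LinearMap.lTensor_comp,
    LinearMap.comp_apply]

/-- The coherd associated to the herd `G`. -/
def associatedCoherd (hG : G.IsCoalgebraic e) : G.AssociatedCoherd :=
  letI := coalgebraOfEquiv hG.equivE
  letI := coalgebraOfEquiv hG.equivF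
  { isCoalgebraE := hG.isCoalgebraE
    isCoalgebraF := hG.isCoalgebraF
    coherd := Coherd.ofCoalgebra hG.equivE hG.equivF hG.equivBar
      (hG.comul_equivE hG.isCoalgebraE) (hG.counit_equivE hG.isCoalgebraE)
      (hG.comul_equivF hG.isCoalgebraF) (hG.counit_equivF hG.isCoalgebraF)
      (ternary G e) hG.ternary_comul hG.ternary_comul_assoc
      -- Associativity of the ternary product is right `A`-linearity of `ev`: both sides are `x ev(y
      -- ⊗ x') ev(y' ⊗ x'')`.
      (fun x y x' y' x'' => by
        simp only [ternary_tmul, TensorProduct.map_tmul, LinearMap.id_apply, G.ev_right, op_mul,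
          mul_smul])
    ρXC_eq := fun x => by
      rw [hG.γ_eq]
      change (G.E.subtype.lTensor T ∘ₗ hG.equivE.toLinearMap.lTensor T) (comul x) = _
      rw [← LinearMap.lTensor_comp, subtype_comp_equivE]
      rfl
    ρDX_eq := fun x => by
      rw [hG.γ_eq, LinearMap.comp_apply, ← assoc_rTensor_rightComul_comul]
      change TensorProduct.assoc k T That T
        ((G.F.subtype.rTensor T ∘ₗ hG.equivF.toLinearMap.rTensor T) (comul x)) = _
      rw [← LinearMap.rTensor_comp, subtype_comp_equivF]
    ρCXbar_eq := fun y => by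
      obtain ⟨c, rfl⟩ := hG.equivBar.surjective y
      simp only [Coherd.ofCoalgebra, LinearMap.comp_apply, LinearEquiv.coe_coe,
        LinearEquiv.symm_apply_apply, TensorProduct.map_map, subtype_comp_equivE,
        subtype_comp_equivBar, hG.hatγhat_equivBar]
      exact assoc_map_map_comul (k := k) e.toLinearMap .id (barComul e) c
    ρXbarD_eq := fun y => by
      obtain ⟨c, rfl⟩ := hG.equivBar.surjective y
      simp only [Coherd.ofCoalgebra, LinearMap.comp_apply, LinearEquiv.coe_coe,
        LinearEquiv.symm_apply_apply, TensorProduct.map_map, subtype_comp_equivF,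
        subtype_comp_equivBar, hG.hatγhat_equivBar]
      exact lTensor_assoc_assoc_map_comul (k := k) e.toLinearMap .id e.toLinearMap (rightComul e) c
    cov_eq := fun t => by
      obtain ⟨c, rfl⟩ := hG.equivE.surjective t
      simp only [Coherd.ofCoalgebra, LinearMap.comp_apply, LinearEquiv.coe_coe,
        LinearEquiv.symm_apply_apply]
      exact hG.cov_leftComul c
    covBar_eq := fun t => by
      obtain ⟨c, rfl⟩ := hG.equivF.surjective t
      simp only [Coherd.ofCoalgebra, LinearMap.comp_apply, LinearEquiv.coe_coe,
        LinearEquiv.symm_apply_apply]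
      exact hG.covBar_rightComul c
    χ_eq := by
      refine TensorProduct.ext' fun x t => ?_
      induction t with
      | zero => simp
      | add u v hu hv => simp only [map_add, TensorProduct.tmul_add, hu, hv]
      | tmul y z =>
        obtain ⟨c, rfl⟩ := hG.equivBar.surjective y
        simp [Coherd.ofCoalgebra, hG.χFull_barComul] }

/-! ### The reconstructed rings -/

section Rings

variable (K : G.AssociatedCoherd)

theorem χ_equivBar (hG : G.IsCoalgebraic e) (x c z : T) :
    letI := K.coalgebraE
    letI := K.coalgebraF
    K.coherd.χ (x ⊗ₜ (hG.equivBar c ⊗ₜ z)) = op (G.ev (e c ⊗ₜ z)) • x := by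
  rw [K.χ_eq]
  simp [hG.χFull_barComul]

/-- The herd prescribes `cov` only after inclusion of the companion in `That ⊗ T ⊗ That`. That
inclusion splits, so the prescription determines `cov` for every associated coherd. -/
theorem cov_equivE (hG : G.IsCoalgebraic e) (c : T) :
    letI := K.coalgebraE
    letI := K.coalgebraF
    K.coherd.cov (hG.equivE c) = hG.equivBar.toLinearMap.rTensor T (comul c) := by
  apply map_injective_of_comp_eq_id hG.retract_bar (LinearMap.id_comp (.id : T →ₗ[k] T))
  apply (TensorProduct.assoc k That (T ⊗[k] That) T).injective
  apply ((TensorProduct.assoc k T That T).lTensor That).injective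
  exact (K.cov_eq _).trans (hG.cov_leftComul c).symm

theorem covBar_equivF (hG : G.IsCoalgebraic e) (c : T) :
    letI := K.coalgebraE
    letI := K.coalgebraF
    K.coherd.covBar (hG.equivF c) = hG.equivBar.toLinearMap.lTensor T (comul c) := by
  apply map_injective_of_comp_eq_id (LinearMap.id_comp (.id : T →ₗ[k] T)) hG.retract_bar
  exact (K.covBar_eq _).trans (hG.covBar_rightComul c).symm

/-- Once the companion is identified with the pen, the isomorphism is induced by `ev`: it is
multiplicative and onto, and its kernel is exactly the module of coequaliser relations. -/
theorem ringA_equiv (hG : G.IsCoalgebraic e) (hev : Function.Surjective G.ev) (t : T)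
    (ht : counit (R := k) t = 1) :
    ∃ φ : K.ringA ≃+* A, ∀ (r : k) (a : K.ringA), φ (r • a) = r • φ a := by
  let := K.coalgebraE
  let := K.coalgebraF
  let Φ : G.bar ⊗[k] T →ₗ[k] A := G.ev ∘ₗ (e.toLinearMap ∘ₗ hG.equivBar.symm.toLinearMap).rTensor T
  have hΦ : ∀ c z, Φ (hG.equivBar c ⊗ₜ z) = G.ev (e c ⊗ₜ z) := fun c z => by simp [Φ]
  -- The right factor `v` acts only through `Φ v`; this yields both multiplicativity and the
  -- computation of the kernel.
  have hmulA : ∀ (c x : T) (v : G.bar ⊗[k] T), K.coherd.mulA (hG.equivBar c ⊗ₜ x) v =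
      hG.equivBar c ⊗ₜ (op (Φ v) • x) := by
    intro c x v
    rw [Coherd.mulA_tmul]
    congr 1
    induction v with
    | zero => simp
    | add u v hu hv => simp only [map_add, TensorProduct.tmul_add, op_add, add_smul, hu, hv]
    | tmul y z =>
      obtain ⟨c, rfl⟩ := hG.equivBar.surjective y
      rw [hG.χ_equivBar, hΦ]
  have hmul : ∀ u v, Φ (K.coherd.mulA u v) = Φ u * Φ v := by
    intro u v
    induction u with
    | zero => simp
    | add u w hu hw => simp only [map_add, LinearMap.add_apply, add_mul, hu, hw]
    | tmul y z =>
      obtain ⟨c, rfl⟩ := hG.equivBar.surjective y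
      rw [hmulA, hΦ, hΦ, G.ev_right]
  have hcov : ∀ c, Φ (K.coherd.cov (hG.equivE c)) = algebraMap k A (counit c) := by
    intro c
    rw [hG.cov_equivE, ← hG.ev_comul, LinearMap.comp_apply,
      ← LinearMap.comp_apply (f := LinearMap.rTensor _ _), ← LinearMap.rTensor_comp,
      LinearMap.comp_assoc, LinearEquiv.symm_comp, LinearMap.comp_id]
    rfl
  have hcounit : ∀ c, counit (R := k) (hG.equivE c) = counit (R := k) c :=
    hG.counit_equivE K.isCoalgebraE
  have hker : LinearMap.range K.coherd.ωA = LinearMap.ker Φ := by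
    apply le_antisymm
    · rintro _ ⟨w, rfl⟩
      rw [LinearMap.mem_ker]
      induction w with
      | zero => simp
      | add u v hu hv => simp only [map_add, hu, hv, add_zero]
      | tmul d u =>
        obtain ⟨c, rfl⟩ := hG.equivE.surjective d
        rw [Coherd.ωA_tmul, map_sub, hmul, hcov, map_smul, hcounit, Algebra.smul_def, sub_self]
    · intro u hu
      rw [LinearMap.mem_ker] at hu
      -- Left multiplication of an element `u` of the kernel by anything vanishes, so `ωA (d ⊗ u) =
      -- -ε(d) u`. The counit of `-t` is `-1`, which makes this value `u` itself.
      refine ⟨hG.equivE (-t) ⊗ₜ u, ?_⟩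
      have h0 : ∀ v, K.coherd.mulA v u = 0 := by
        intro v
        induction v with
        | zero => simp
        | add u w hu hw => simp only [map_add, LinearMap.add_apply, hu, hw, add_zero]
        | tmul y z =>
          obtain ⟨c, rfl⟩ := hG.equivBar.surjective y
          rw [hmulA, hu, op_zero, zero_smul, TensorProduct.tmul_zero]
      rw [Coherd.ωA_tmul, h0, hcounit, map_neg, ht]
      exact (zero_sub _).trans ((congrArg Neg.neg (neg_one_smul k u)).trans (neg_neg u))
  have hsurj : Function.Surjective Φ := hev.comp ((hG.equivBar.symm.trans e).rTensor T).surjective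
  let ψ : K.coherd.ringA ≃ₗ[k] A :=
    (Submodule.quotEquivOfEq _ _ hker).trans (Φ.quotKerEquivOfSurjective hsurj)
  refine ⟨{ ψ with map_mul' := ?_ }, ψ.map_smul⟩
  intro a b
  obtain ⟨a, rfl⟩ := Submodule.mkQ_surjective _ a
  obtain ⟨b, rfl⟩ := Submodule.mkQ_surjective _ b
  exact hmul a b

/-- Mirror image for `evHat`: here the left factor of a product acts only through its evaluation,
and multiplicativity is left `B`-linearity. -/
theorem ringB_equiv (hG : G.IsCoalgebraic e) (hev : Function.Surjective G.evHat) (t : T)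
    (ht : counit (R := k) t = 1) :
    ∃ φ : K.ringB ≃+* B, ∀ (r : k) (b : K.ringB), φ (r • b) = r • φ b := by
  let := K.coalgebraE
  let := K.coalgebraF
  let Φ : T ⊗[k] G.bar →ₗ[k] B :=
    G.evHat ∘ₗ (e.toLinearMap ∘ₗ hG.equivBar.symm.toLinearMap).lTensor T
  have hΦ : ∀ x c, Φ (x ⊗ₜ hG.equivBar c) = G.evHat (x ⊗ₜ e c) := fun c z => by simp [Φ]
  have hmulB : ∀ (u : T ⊗[k] G.bar) (x c : T), K.coherd.mulB u (x ⊗ₜ hG.equivBar c) =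
      (Φ u • x) ⊗ₜ hG.equivBar c := by
    intro u x c
    rw [Coherd.mulB_tmul_right]
    congr 1
    induction u with
    | zero => simp
    | add u v hu hv => simp only [map_add, TensorProduct.add_tmul, add_smul, hu, hv]
    | tmul z y =>
      obtain ⟨c, rfl⟩ := hG.equivBar.surjective y
      rw [TensorProduct.assoc_tmul, hG.χ_equivBar, hΦ, G.evHat_smul]
  have hmul : ∀ u v, Φ (K.coherd.mulB u v) = Φ u * Φ v := by
    intro u v
    induction v with
    | zero => simp
    | add v w hv hw => simp only [map_add, mul_add, hv, hw]
    | tmul z y =>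
      obtain ⟨c, rfl⟩ := hG.equivBar.surjective y
      rw [hmulB, hΦ, hΦ, G.evHat_left]
  have hcov : ∀ c, Φ (K.coherd.covBar (hG.equivF c)) = algebraMap k B (counit c) := by
    intro c
    rw [hG.covBar_equivF, ← hG.evHat_comul, LinearMap.comp_apply,
      ← LinearMap.comp_apply (f := LinearMap.lTensor _ _), ← LinearMap.lTensor_comp,
      LinearMap.comp_assoc, LinearEquiv.symm_comp, LinearMap.comp_id]
    rfl
  have hcounit : ∀ c, counit (R := k) (hG.equivF c) = counit (R := k) c :=
    hG.counit_equivF K.isCoalgebraF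
  have hker : LinearMap.range K.coherd.ωB = LinearMap.ker Φ := by
    apply le_antisymm
    · rintro _ ⟨w, rfl⟩
      rw [LinearMap.mem_ker]
      induction w with
      | zero => simp
      | add u v hu hv => simp only [map_add, hu, hv, add_zero]
      | tmul u d =>
        obtain ⟨c, rfl⟩ := hG.equivF.surjective d
        rw [Coherd.ωB_tmul, map_sub, hmul, hcov, map_smul, hcounit, Algebra.smul_def,
          Algebra.commutes, sub_self]
    · intro u hu
      rw [LinearMap.mem_ker] at hu
      -- With `t` of counit one, the relation at `u ⊗ t` is `-u`.
      rw [← neg_mem_iff]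
      refine ⟨u ⊗ₜ hG.equivF t, ?_⟩
      have h0 : ∀ v, K.coherd.mulB u v = 0 := by
        intro v
        induction v with
        | zero => simp
        | add u w hu hw => simp only [map_add, hu, hw, add_zero]
        | tmul z y =>
          obtain ⟨c, rfl⟩ := hG.equivBar.surjective y
          rw [hmulB, hu, zero_smul, TensorProduct.zero_tmul]
      rw [Coherd.ωB_tmul, h0, hcounit, ht, one_smul, zero_sub]
  have hsurj : Function.Surjective Φ := hev.comp ((hG.equivBar.symm.trans e).lTensor T).surjective
  let ψ : K.coherd.ringB ≃ₗ[k] B :=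
    (Submodule.quotEquivOfEq _ _ hker).trans (Φ.quotKerEquivOfSurjective hsurj)
  refine ⟨{ ψ with map_mul' := ?_ }, ψ.map_smul⟩
  intro a b
  obtain ⟨a, rfl⟩ := Submodule.mkQ_surjective _ a
  obtain ⟨b, rfl⟩ := Submodule.mkQ_surjective _ b
  exact hmul a b

end Rings

/-- The coalgebras `E` and `F`, the coherd, and the rings attached to a herd on a coalgebra. -/
theorem reconstruction (hG : G.IsCoalgebraic e) (hev : Function.Surjective G.ev)
    (hevHat : Function.Surjective G.evHat) {t : T}
    (ht : counit (R := k) t = 1) :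
    (∃! cE : Coalgebra k G.E, G.IsCoalgebraE cE) ∧
    (∀ cE : Coalgebra k G.E, G.IsCoalgebraE cE → Nonempty (G.E ≃ₗc[k] T)) ∧
    (∃! cF : Coalgebra k G.F, G.IsCoalgebraF cF) ∧
    (∀ cF : Coalgebra k G.F, G.IsCoalgebraF cF → Nonempty (G.F ≃ₗc[k] T)) ∧
    Nonempty G.AssociatedCoherd ∧
    ∀ K : G.AssociatedCoherd,
      (∃ φ : K.ringA ≃+* A, ∀ (r : k) (a : K.ringA), φ (r • a) = r • φ a) ∧
      (∃ φ : K.ringB ≃+* B, ∀ (r : k) (b : K.ringB), φ (r • b) = r • φ b) :=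
  ⟨hG.existsUnique_coalgebraE, fun _ h => ⟨(hG.coalgEquivE h).symm⟩,
    hG.existsUnique_coalgebraF, fun _ h => ⟨(hG.coalgEquivF h).symm⟩,
    ⟨hG.associatedCoherd⟩, fun K => ⟨hG.ringA_equiv K hev t ht, hG.ringB_equiv K hevHat t ht⟩⟩

end IsCoalgebraic
end Herd
end BimoduleHerd

/-! ### The herd of a Galois co-object -/

namespace GaloisCoobject

open BimoduleHerd

section

variable {k H C : Type u} [CommRing k] [CommRing H] [HopfAlgebra k H]
    [AddCommGroup C] [Module k C] [Coalgebra k C] [Module H C] [IsScalarTower k H C]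

variable (k H C) in
-- The adjunction counit at `N = k` is onto, and it sends `(c ⊗ s) ⊗ r` to `r s ε(c) = ε(r s c)`.
-- All its values, in particular `1`, are therefore values of `ε`.
theorem exists_counit_eq_one [IsGaloisCoobject k H C] : ∃ e : C, counit (R := k) e = 1 := by
  have h : ∀ x : coinv k H (C ⊗[k] k), ∃ c : C, adjCounit k H C k x = counit (R := k) c := by
    intro x
    induction x using TensorProduct.induction_on with
    | zero => exact ⟨0, by simp⟩
    | add x y hx hy =>
      obtain ⟨a, ha⟩ := hx
      obtain ⟨b, hb⟩ := hy
      exact ⟨a + b, by rw [map_add, map_add, ha, hb]⟩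
    | tmul t r =>
      induction t with
      | zero => exact ⟨0, by simp⟩
      | add x y hx hy =>
        obtain ⟨a, ha⟩ := hx
        obtain ⟨b, hb⟩ := hy
        exact ⟨a + b, by rw [TensorProduct.add_tmul, map_add, map_add, ha, hb]⟩
      | tmul c s =>
        refine ⟨((show k from r) * s) • c, ?_⟩
        refine (adjCounit_tmul k H C k c s r).trans ?_
        simp only [map_smul, smul_eq_mul]
        rw [mul_comm (counit c)]
        exact (mul_assoc (show k from r) s _).symm
  obtain ⟨x, hx⟩ := (IsGaloisCoobject.counit_bijective (k := k) (H := H) (C := C) k).surjective 1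
  obtain ⟨c, hc⟩ := h x
  exact ⟨c, hc.symm.trans hx⟩

variable (k H C) in
-- If `ε(e) = 1`, then `δ(e ⊗ h)` is a preimage of `h`.
theorem cotranslation_surjective [IsGaloisCoobject k H C] :
    Function.Surjective (cotranslation k H C) := fun h => by
  obtain ⟨e, he⟩ := exists_counit_eq_one k H C
  exact ⟨_, by rw [cotranslation_delta e h, he, one_smul]⟩

variable (k H) in
theorem algebraMap_injective_of_hopfAlgebra : Function.Injective (algebraMap k H) :=
  Function.LeftInverse.injective (g := counit) (Bialgebra.counit_algebraMap (A := H))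

variable (k) in
-- The map `n ↦ e ⊗ n` embeds `N` in `C ⊗ N`, split by `ε ⊗ N`, so tensoring with `C` kills no
-- nonzero module.
theorem faithfullyFlat_of_counit_eq_one [Module.Flat k C] {e : C} (he : counit (R := k) e = 1) :
    Module.FaithfullyFlat k C := by
  rw [Module.FaithfullyFlat.iff_flat_and_lTensor_faithful]
  refine ⟨inferInstance, fun N _ _ _ => ?_⟩
  refine (Function.LeftInverse.injective (f := fun n : N => e ⊗ₜ[k] n)
    (g := applyLeft counit N) fun n => ?_).nontrivial
  simp [he]

variable [Module Hᵐᵒᵖ C] [IsCentralScalar H C] [IsGaloisCoobject k H C]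

variable (k H C) in
-- Since `Δ(c) = δ(c ⊗ 1)`, `ev` takes the value `ε(c) 1` on it, and `S(1) = 1` gives the same for
-- `evHat`. The unit maps are injective because the counit of `H` retracts them.
theorem isCoalgebraic_herd : (herd k H C).IsCoalgebraic (toHat k H C) where
  γ_eq := by
    change ((toHat k H C).toLinearMap.rTensor C).lTensor C ∘ₗ comul.lTensor C ∘ₗ comul = _
    rw [← LinearMap.comp_assoc, ← LinearMap.lTensor_comp]
    rfl
  ev_comul c := by
    change cotranslation k H C ((toHat k H C).symm.toLinearMap.rTensor C
      ((toHat k H C).toLinearMap.rTensor C (comul c))) = _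
    rw [← LinearMap.comp_apply (f := LinearMap.rTensor _ _), ← LinearMap.rTensor_comp,
      LinearEquiv.symm_comp, LinearMap.rTensor_id, LinearMap.id_apply, cotranslation_comul,
      Algebra.algebraMap_eq_smul_one]
  evHat_comul c := by
    change antipode k (cotranslation k H C ((toHat k H C).symm.toLinearMap.lTensor C
      ((toHat k H C).toLinearMap.lTensor C (comul c)))) = _
    rw [← LinearMap.comp_apply (f := LinearMap.lTensor _ _), ← LinearMap.lTensor_comp,
      LinearEquiv.symm_comp, LinearMap.lTensor_id, LinearMap.id_apply, cotranslation_comul,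
      Algebra.algebraMap_eq_smul_one, map_smul, antipode_one]
  algebraMap_left_injective := algebraMap_injective_of_hopfAlgebra k H
  algebraMap_right_injective := algebraMap_injective_of_hopfAlgebra k H

variable (k H C) in
theorem ev_herd_surjective : Function.Surjective (herd k H C).ev :=
  (cotranslation_surjective k H C).comp ((toHat k H C).symm.rTensor C).surjective

variable (k H C) in
-- The antipode is onto, being its own inverse on a commutative Hopf algebra.
theorem evHat_herd_surjective : Function.Surjective (herd k H C).evHat :=
  (Function.RightInverse.surjective (antipode_antipode (k := k))).comp
    ((cotranslation_surjective k H C).comp ((toHat k H C).symm.lTensor C).surjective)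

variable (k H C) in
theorem isTame_herd [Module.Flat k C] : (herd k H C).IsTame where
  ev_surjective := ev_herd_surjective k H C
  evHat_surjective := evHat_herd_surjective k H C
  faithfullyFlat :=
    let ⟨_, he⟩ := exists_counit_eq_one k H C
    faithfullyFlat_of_counit_eq_one k he

end

end GaloisCoobject

end

theorem mainTheorem9 {k H C : Type u} [CommRing k] [CommRing H] [HopfAlgebra k H]
    [AddCommGroup C] [Module k C] [Coalgebra k C] [Module H C] [Module Hᵐᵒᵖ C]
    [IsCentralScalar H C] [IsScalarTower k H C] [GaloisCoobject.IsGaloisCoobject k H C] :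
    -- the coalgebra `E` is well defined and isomorphic to `C`
    (∃! cE : Coalgebra k (GaloisCoobject.herd k H C).E,
      (GaloisCoobject.herd k H C).IsCoalgebraE cE) ∧
    (∀ cE : Coalgebra k (GaloisCoobject.herd k H C).E,
      (GaloisCoobject.herd k H C).IsCoalgebraE cE →
      Nonempty ((GaloisCoobject.herd k H C).E ≃ₗc[k] C)) ∧
    -- the coalgebra `F` is well defined and isomorphic to `C`
    (∃! cF : Coalgebra k (GaloisCoobject.herd k H C).F,
      (GaloisCoobject.herd k H C).IsCoalgebraF cF) ∧
    (∀ cF : Coalgebra k (GaloisCoobject.herd k H C).F,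
      (GaloisCoobject.herd k H C).IsCoalgebraF cF →
      Nonempty ((GaloisCoobject.herd k H C).F ≃ₗc[k] C)) ∧
    -- if `C` is flat, the herd is tame and the rings of the associated coherd are isomorphic to `H`
    (Module.Flat k C →
      (GaloisCoobject.herd k H C).IsTame ∧
      Nonempty (GaloisCoobject.herd k H C).AssociatedCoherd ∧
      ∀ K : (GaloisCoobject.herd k H C).AssociatedCoherd,
        (∃ φ : K.ringA ≃+* H, ∀ (r : k) (a : K.ringA), φ (r • a) = r • φ a) ∧
        (∃ φ : K.ringB ≃+* H, ∀ (r : k) (b : K.ringB), φ (r • b) = r • φ b)) := by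
  obtain ⟨e, he⟩ := GaloisCoobject.exists_counit_eq_one k H C
  obtain ⟨h1, h2, h3, h4, h5, h6⟩ := (GaloisCoobject.isCoalgebraic_herd k H C).reconstruction
    (GaloisCoobject.ev_herd_surjective k H C) (GaloisCoobject.evHat_herd_surjective k H C) he
  exact ⟨h1, h2, h3, h4, fun _ => ⟨GaloisCoobject.isTame_herd k H C, h5, h6⟩⟩
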